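/- \begin{theorem} Let $p$ be a prime and let $R$ be a commutative ring of coefficients (for instance $\mathbb{Z}$, $\mathbb{Q}$ or $\mathbb{C}$). For a group $S$ and a subgroup $\Gamma\le S$ forming a Hecke pair, let $H(\Gamma,S)$ be the Hecke algebra over $R$: its elements are the finite formal sums of right cosets $\sum_i a_i\,\Gamma g_i$ ($a_i\in R$, $g_i\in S$) that are invariant under right multiplication by $\Gamma$, with product $(\sum_i a_i\Gamma g_i)(\sum_j b_j\Gamma h_j)=\sum_{i,j}a_ib_j\,\Gamma g_ih_j$. A double coset $\Gamma g\Gamma$ is regarded as the element of $H(\Gamma,S)$ that is the sum of the right cosets contained in it. Put $\Gamma_4=\mathrm{GL}_4(\mathbb{Z}_p)$ and $H_4=H(\Gamma_4,\mathrm{GL}_4(\mathbb{Q}_p))$. Let $P=P_{1,2,1}\subset\mathrm{GL}_4(\mathbb{Q}_p)$ be the parabolic subgroup of block upper triangular matrices with diagonal blocks of sizes $1,2,1$, let $\Gamma_{1,2,1}=P\cap\mathrm{GL}_4(\mathbb{Z}_p)$, and let $H_{1,2,1}=H(\Gamma_{1,2,1},P)$. For $a,b,c,d\in\mathbb{Q}_p^\times$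 put $$T(a,b,c,d)=\Gamma_4\,\mathrm{diag}(a,b,c,d)\,\Gamma_4\in H_4,\qquad T_0(a,b,c,d)=\Gamma_{1,2,1}\,\mathrm{diag}(a,b,c,d)\,\Gamma_{1,2,1}\in H_{1,2,1}.$$ Since $\mathrm{GL}_4(\mathbb{Q}_p)=\Gamma_4P$, every element of $H_4$ can be written as $\sum_i a_i\Gamma_4g_i$ with all $g_i\in P$, and $\sum_i a_i\Gamma_4g_i\mapsto\sum_i a_i\Gamma_{1,2,1}g_i$ is an injective ring homomorphism $\varepsilon:H_4\to H_{1,2,1}$. Let $T_1=T(1,1,1,p)$, $T_2=T(1,1,p,p)$, $T_3=T(1,p,p,p)$, $\Delta=T(p,p,p,p)$ and $$Q_4(t)=1-T_1t+pT_2t^2-p^3T_3t^3+p^6\Delta t^4\in H_4[t],$$ where the variable $t$ commutes with the coefficients. Then, after applying $\varepsilon$ to the coefficients of $Q_4$, one has in $H_{1,2,1}[t]$ the factorisation $$\varepsilon(Q_4)(t)=(1-\Lambda_-^{1,3}t)\,(1-X_1t+pX_2t^2)\,(1-\Lambda_+^{3,1}t),$$ where $\Lambda_-^{1,3}=T_0(p,1,1,1)$,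 $\Lambda_+^{3,1}=T_0(1,1,1,p)$, $X_1=T_0(1,1,p,1)$ and $X_2=T_0(1,p,p,1)$. \end{theorem} -/

import Mathlib

open scoped Pointwise

/-! ### Abstract Hecke algebras -/

/-- The set `Γ \ G` of right cosets `Γ g`. -/
abbrev RightCoset {G : Type*} [Group G] (Γ : Subgroup G) : Type _ :=
  Quotient (QuotientGroup.rightRel Γ)

namespace RightCoset

variable {G : Type*} [Group G] {Γ : Subgroup G}

/-- The right coset `Γ g`. -/
def mk (Γ : Subgroup G) (g : G) : RightCoset Γ := Quotient.mk _ g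

theorem mk_eq_mk {x y : G} : mk Γ x = mk Γ y ↔ y * x⁻¹ ∈ Γ := by
  unfold mk
  rw [Quotient.eq]
  exact QuotientGroup.rightRel_apply

theorem mk_out (c : RightCoset Γ) : mk Γ c.out = c := Quotient.out_eq c

/-- Right multiplication `Γ x ↦ Γ x g`. -/
def mulRight (g : G) : RightCoset Γ → RightCoset Γ :=
  Quotient.map (fun x => x * g) (by
    intro x y h
    change QuotientGroup.rightRel Γ _ _ at h
    change QuotientGroup.rightRel Γ _ _
    rw [QuotientGroup.rightRel_apply] at h ⊢
    simpa [mul_assoc] using h)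

theorem mulRight_mk (g x : G) : mulRight g (mk Γ x) = mk Γ (x * g) := rfl

theorem mulRight_mulRight (g h : G) (c : RightCoset Γ) :
    mulRight h (mulRight g c) = mulRight (g * h) c := by
  induction c using Quotient.inductionOn with
  | h x => exact congrArg (mk Γ) (mul_assoc x g h)

theorem mulRight_one (c : RightCoset Γ) : mulRight 1 c = c := by
  induction c using Quotient.inductionOn with
  | h x => exact congrArg (mk Γ) (mul_one x)

end RightCoset

namespace HeckeAlg

variable {G : Type*} [Group G] (R : Type*) [CommRing R] (Γ : Subgroup G)

/-- Right translation `∑ aᵢ Γ gᵢ ↦ ∑ aᵢ Γ gᵢ g` of finite formal sums of right cosets. -/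
noncomputable def translate (g : G) : (RightCoset Γ →₀ R) →ₗ[R] (RightCoset Γ →₀ R) :=
  Finsupp.lmapDomain R R (RightCoset.mulRight g)

/-- The finite formal sums of right cosets `∑ aᵢ Γ gᵢ` that are invariant under right
multiplication by `Γ`. -/
noncomputable def invariants : Submodule R (RightCoset Γ →₀ R) where
  carrier := {f | ∀ γ ∈ Γ, translate R Γ γ f = f}
  add_mem' := by
    intro f h hf hh γ hγ
    rw [map_add, hf γ hγ, hh γ hγ]
  zero_mem' := by
    intro γ _
    rw [map_zero]
  smul_mem' := by
    intro a f hf γ hγ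
    rw [map_smul, hf γ hγ]

variable {R Γ}

/-- The product `(∑ aᵢ Γ gᵢ) (∑ bⱼ Γ hⱼ) = ∑ aᵢ bⱼ Γ gᵢ hⱼ`. It does not depend on the choice of
the representatives `hⱼ` if the first factor is invariant under `Γ`. -/
noncomputable def convolve (f h : RightCoset Γ →₀ R) : RightCoset Γ →₀ R :=
  h.sum fun d b => b • translate R Γ d.out f

theorem translate_single (g x : G) (a : R) :
    translate R Γ g (Finsupp.single (RightCoset.mk Γ x) a) =
      Finsupp.single (RightCoset.mk Γ (x * g)) a := by
  simp [translate, Finsupp.mapDomain_single, RightCoset.mulRight_mk]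

theorem translate_translate (g h : G) (f : RightCoset Γ →₀ R) :
    translate R Γ h (translate R Γ g f) = translate R Γ (g * h) f := by
  simp only [translate, Finsupp.lmapDomain_apply]
  rw [← Finsupp.mapDomain_comp]
  congr 1
  funext c
  exact RightCoset.mulRight_mulRight g h c

theorem translate_one (f : RightCoset Γ →₀ R) : translate R Γ 1 f = f := by
  simp only [translate, Finsupp.lmapDomain_apply]
  have h : (RightCoset.mulRight (1 : G) : RightCoset Γ → RightCoset Γ) = id := by
    funext c
    exact RightCoset.mulRight_one c
  rw [h, Finsupp.mapDomain_id]

theorem translate_eq_of_mk_eq {f : RightCoset Γ →₀ R} (hf : f ∈ invariants R Γ) {x y : G}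
    (h : RightCoset.mk Γ x = RightCoset.mk Γ y) : translate R Γ x f = translate R Γ y f := by
  rw [RightCoset.mk_eq_mk] at h
  have hy : y = (y * x⁻¹) * x := by group
  rw [hy, ← translate_translate, hf _ h]

theorem convolve_add (f h k : RightCoset Γ →₀ R) :
    convolve f (h + k) = convolve f h + convolve f k := by
  classical
  exact Finsupp.sum_add_index' (by simp) (by intros; rw [add_smul])

theorem add_convolve (f h k : RightCoset Γ →₀ R) :
    convolve (f + h) k = convolve f k + convolve h k := by
  simp [convolve, smul_add, Finsupp.sum_add]

theorem convolve_smul (f h : RightCoset Γ →₀ R) (a : R) :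
    convolve f (a • h) = a • convolve f h := by
  unfold convolve
  rw [Finsupp.sum_smul_index' (by simp), Finsupp.smul_sum]
  simp [mul_smul]

theorem convolve_single {f : RightCoset Γ →₀ R} (hf : f ∈ invariants R Γ) (x : G) (b : R) :
    convolve f (Finsupp.single (RightCoset.mk Γ x) b) = b • translate R Γ x f := by
  unfold convolve
  rw [Finsupp.sum_single_index (by simp),
    translate_eq_of_mk_eq hf (RightCoset.mk_out (RightCoset.mk Γ x))]

theorem finsupp_induction {P : (RightCoset Γ →₀ R) → Prop} (h : RightCoset Γ →₀ R)
    (h0 : P 0) (hadd : ∀ f k, P f → P k → P (f + k))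
    (hs : ∀ x b, P (Finsupp.single (RightCoset.mk Γ x) b)) : P h := by
  induction h using Finsupp.induction_linear with
  | zero => exact h0
  | add f k hf hk => exact hadd f k hf hk
  | single c b =>
    rw [← RightCoset.mk_out c]
    exact hs _ _

theorem convolve_zero (f : RightCoset Γ →₀ R) : convolve f 0 = 0 := by
  simp [convolve]

theorem zero_convolve (f : RightCoset Γ →₀ R) : convolve 0 f = 0 := by
  simp [convolve]

theorem convolve_translate {f : RightCoset Γ →₀ R} (hf : f ∈ invariants R Γ) (g : G)
    (h : RightCoset Γ →₀ R) :
    convolve f (translate R Γ g h) = translate R Γ g (convolve f h) := by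
  induction h using finsupp_induction with
  | h0 => simp [convolve_zero]
  | hadd k l hk hl => rw [map_add, convolve_add, hk, hl, convolve_add, map_add]
  | hs x b =>
    rw [translate_single, convolve_single hf, convolve_single hf, map_smul, translate_translate]

theorem convolve_mem {f h : RightCoset Γ →₀ R} (hf : f ∈ invariants R Γ)
    (hh : h ∈ invariants R Γ) : convolve f h ∈ invariants R Γ := by
  intro γ hγ
  rw [← convolve_translate hf, hh γ hγ]

theorem convolve_assoc {f h : RightCoset Γ →₀ R} (hf : f ∈ invariants R Γ)
    (hh : h ∈ invariants R Γ) (k : RightCoset Γ →₀ R) :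
    convolve (convolve f h) k = convolve f (convolve h k) := by
  induction k using finsupp_induction with
  | h0 => simp [convolve_zero]
  | hadd k l hk hl => rw [convolve_add, hk, hl, convolve_add, convolve_add]
  | hs x b =>
    rw [convolve_single (convolve_mem hf hh), convolve_single hh, convolve_smul,
      convolve_translate hf]

theorem one_mem : Finsupp.single (RightCoset.mk Γ 1) (1 : R) ∈ invariants R Γ := by
  intro γ hγ
  rw [translate_single]
  congr 1
  rw [RightCoset.mk_eq_mk]
  simpa using hγ

theorem one_convolve (h : RightCoset Γ →₀ R) :
    convolve (Finsupp.single (RightCoset.mk Γ 1) (1 : R)) h = h := by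
  induction h using finsupp_induction with
  | h0 => simp [convolve_zero]
  | hadd k l hk hl => rw [convolve_add, hk, hl]
  | hs x b =>
    rw [convolve_single one_mem, translate_single]
    simp

end HeckeAlg

/-- The Hecke algebra `H(Γ, G)` with coefficients in `R`: the `R`-module of `Γ`-invariant finite
formal sums of right cosets `∑ aᵢ Γ gᵢ`, with the product
`(∑ aᵢ Γ gᵢ) (∑ bⱼ Γ hⱼ) = ∑ aᵢ bⱼ Γ gᵢ hⱼ`. -/
def HeckeAlg {G : Type*} [Group G] (R : Type*) [CommRing R] (Γ : Subgroup G) : Type _ :=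
  ↥(HeckeAlg.invariants R Γ)

namespace HeckeAlg

variable {G : Type*} [Group G] {R : Type*} [CommRing R] {Γ : Subgroup G}

noncomputable instance : AddCommGroup (HeckeAlg R Γ) :=
  inferInstanceAs (AddCommGroup (HeckeAlg.invariants R Γ))

noncomputable instance : Module R (HeckeAlg R Γ) :=
  inferInstanceAs (Module R (HeckeAlg.invariants R Γ))

/-- The formal sum of right cosets underlying an element of the Hecke algebra. -/
def toFinsupp (X : HeckeAlg R Γ) : RightCoset Γ →₀ R := X.1

theorem toFinsupp_mem (X : HeckeAlg R Γ) : X.toFinsupp ∈ invariants R Γ := X.2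

theorem toFinsupp_injective :
    Function.Injective (toFinsupp : HeckeAlg R Γ → (RightCoset Γ →₀ R)) :=
  Subtype.val_injective

theorem toFinsupp_add (X Y : HeckeAlg R Γ) :
    (X + Y).toFinsupp = X.toFinsupp + Y.toFinsupp := rfl

theorem toFinsupp_zero : (0 : HeckeAlg R Γ).toFinsupp = 0 := rfl

noncomputable instance : Mul (HeckeAlg R Γ) :=
  ⟨fun X Y => ⟨convolve X.toFinsupp Y.toFinsupp, convolve_mem X.2 Y.2⟩⟩

noncomputable instance : One (HeckeAlg R Γ) :=
  ⟨⟨Finsupp.single (RightCoset.mk Γ 1) 1, one_mem⟩⟩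

theorem toFinsupp_mul (X Y : HeckeAlg R Γ) :
    (X * Y).toFinsupp = convolve X.toFinsupp Y.toFinsupp := rfl

theorem toFinsupp_one :
    (1 : HeckeAlg R Γ).toFinsupp = Finsupp.single (RightCoset.mk Γ 1) 1 := rfl

noncomputable instance : Ring (HeckeAlg R Γ) :=
  { (inferInstance : AddCommGroup (HeckeAlg R Γ)),
    (inferInstance : Mul (HeckeAlg R Γ)),
    (inferInstance : One (HeckeAlg R Γ)) with
    left_distrib := fun X Y Z => toFinsupp_injective (convolve_add _ _ _)
    right_distrib := fun X Y Z => toFinsupp_injective (add_convolve _ _ _)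
    zero_mul := fun X => toFinsupp_injective (zero_convolve X.toFinsupp)
    mul_zero := fun X => toFinsupp_injective (convolve_zero X.toFinsupp)
    mul_assoc := fun X Y Z => toFinsupp_injective (convolve_assoc (toFinsupp_mem X) (toFinsupp_mem Y) _)
    one_mul := fun X => toFinsupp_injective (one_convolve _)
    mul_one := fun X => toFinsupp_injective (by
      rw [toFinsupp_mul, toFinsupp_one, convolve_single (toFinsupp_mem X), one_smul,
        translate_one]) }

/-- The set of right cosets contained in the double coset `Γ g Γ`. -/
def cosetsIn (Γ : Subgroup G) (g : G) : Set (RightCoset Γ) :=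
  {c | ∃ γ ∈ Γ, c = RightCoset.mk Γ (g * γ)}

theorem cosetsIn_finite (Γ : Subgroup G) [h : IsHeckeTriple (⊤ : Submonoid G) Γ Γ] (g : G) :
    (cosetsIn Γ g).Finite := by
  classical
  have hc : Subgroup.Commensurable (ConjAct.toConjAct g⁻¹ • Γ) Γ := by
    have := h.le_commensurator_right (show g⁻¹ ∈ (⊤ : Submonoid G) from trivial)
    exact this
  have hfi : ((ConjAct.toConjAct g⁻¹ • Γ).subgroupOf Γ).FiniteIndex := ⟨hc.1⟩
  have hfin : Finite (Γ ⧸ (ConjAct.toConjAct g⁻¹ • Γ).subgroupOf Γ) :=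
    Subgroup.finite_quotient_of_finiteIndex (H := (ConjAct.toConjAct g⁻¹ • Γ).subgroupOf Γ)
  let φ : (Γ ⧸ (ConjAct.toConjAct g⁻¹ • Γ).subgroupOf Γ) → RightCoset Γ :=
    fun c => RightCoset.mk Γ (g * ((c.out : Γ) : G)⁻¹)
  refine (Set.finite_range φ).subset ?_
  rintro c ⟨γ, hγ, rfl⟩
  let γ' : Γ := ⟨γ⁻¹, Γ.inv_mem hγ⟩
  refine ⟨QuotientGroup.mk γ', ?_⟩
  obtain ⟨k, hk⟩ := QuotientGroup.mk_out_eq_mul ((ConjAct.toConjAct g⁻¹ • Γ).subgroupOf Γ) γ'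
  have hk2 : ((k : Γ) : G) ∈ ConjAct.toConjAct g⁻¹ • Γ := k.2
  rw [Subgroup.mem_pointwise_smul_iff_inv_smul_mem] at hk2
  simp only [φ]
  rw [hk, RightCoset.mk_eq_mk]
  simp only [ConjAct.smul_def, map_inv, inv_inv, ConjAct.ofConjAct_toConjAct] at hk2
  simp only [γ', Subgroup.coe_mul, mul_inv_rev, inv_inv]
  convert hk2 using 1
  group

/-- The double coset `Γ g Γ` as an element of the Hecke algebra: the sum of all right cosets
that it contains. Finiteness holds because `(Γ, G)` is a Hecke pair. -/
noncomputable def doubleCoset (R : Type*) [CommRing R] (Γ : Subgroup G)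
    [IsHeckeTriple (⊤ : Submonoid G) Γ Γ] (g : G) : HeckeAlg R Γ :=
  ⟨∑ c ∈ (cosetsIn_finite Γ g).toFinset, Finsupp.single c 1, by
    classical
    intro γ hγ
    rw [map_sum]
    refine Finset.sum_bij' (fun c _ => RightCoset.mulRight γ c)
      (fun c _ => RightCoset.mulRight γ⁻¹ c) ?_ ?_ ?_ ?_ ?_
    · intro c hc
      rw [Set.Finite.mem_toFinset] at hc ⊢
      obtain ⟨δ, hδ, rfl⟩ := hc
      exact ⟨δ * γ, Γ.mul_mem hδ hγ, by rw [RightCoset.mulRight_mk, mul_assoc]⟩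
    · intro c hc
      rw [Set.Finite.mem_toFinset] at hc ⊢
      obtain ⟨δ, hδ, rfl⟩ := hc
      exact ⟨δ * γ⁻¹, Γ.mul_mem hδ (Γ.inv_mem hγ), by rw [RightCoset.mulRight_mk, mul_assoc]⟩
    · intro c _
      rw [RightCoset.mulRight_mulRight, mul_inv_cancel, RightCoset.mulRight_one]
    · intro c _
      rw [RightCoset.mulRight_mulRight, inv_mul_cancel, RightCoset.mulRight_one]
    · intro c _
      simp [translate, Finsupp.mapDomain_single]⟩

/-! ### The embedding of Hecke algebras -/

/-- If `Γ₀ = Γ ∩ S₀` and `G = Γ S₀`, then `Γ₀ s ↦ Γ s` is a bijection from `Γ₀ \ S₀`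
to `Γ \ G`. -/
noncomputable def cosetEquiv (Γ S₀ : Subgroup G) (hS : ∀ g : G, ∃ γ ∈ Γ, ∃ s ∈ S₀, g = γ * s) :
    RightCoset (Γ.subgroupOf S₀) ≃ RightCoset Γ :=
  Equiv.ofBijective
    (Quotient.map (fun s : S₀ => (s : G)) (by
      intro x y h
      change QuotientGroup.rightRel _ _ _ at h
      change QuotientGroup.rightRel _ _ _
      rw [QuotientGroup.rightRel_apply] at h ⊢
      exact h))
    (by
      constructor
      · intro c d
        induction c using Quotient.inductionOn with
        | h x =>
          induction d using Quotient.inductionOn with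
          | h y =>
            intro h
            have h' : RightCoset.mk Γ (x : G) = RightCoset.mk Γ (y : G) := h
            rw [RightCoset.mk_eq_mk] at h'
            exact RightCoset.mk_eq_mk.2 h'
      · intro c
        induction c using Quotient.inductionOn with
        | h g =>
          obtain ⟨γ, hγ, s, hs, rfl⟩ := hS g
          refine ⟨RightCoset.mk _ ⟨s, hs⟩, ?_⟩
          change RightCoset.mk Γ s = RightCoset.mk Γ (γ * s)
          rw [RightCoset.mk_eq_mk]
          simpa using hγ)

variable {S₀ : Subgroup G} (hS : ∀ g : G, ∃ γ ∈ Γ, ∃ s ∈ S₀, g = γ * s)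

theorem cosetEquiv_mk (s : S₀) :
    cosetEquiv Γ S₀ hS (RightCoset.mk _ s) = RightCoset.mk Γ (s : G) := rfl

theorem cosetEquiv_symm_mk (s : S₀) :
    (cosetEquiv Γ S₀ hS).symm (RightCoset.mk Γ (s : G)) = RightCoset.mk _ s := by
  rw [← cosetEquiv_mk hS, Equiv.symm_apply_apply]

theorem exists_rep (hS : ∀ g : G, ∃ γ ∈ Γ, ∃ s ∈ S₀, g = γ * s) (g : G) : ∃ s : S₀, RightCoset.mk Γ g = RightCoset.mk Γ (s : G) := by
  obtain ⟨γ, hγ, s, hs, rfl⟩ := hS g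
  exact ⟨⟨s, hs⟩, by rw [RightCoset.mk_eq_mk]; simpa using Γ.inv_mem hγ⟩

/-- The map `∑ aᵢ Γ gᵢ ↦ ∑ aᵢ Γ₀ gᵢ` (with all `gᵢ ∈ S₀`) on formal sums. -/
noncomputable def restrictCosets (R : Type*) [CommRing R] (hS : ∀ g : G, ∃ γ ∈ Γ, ∃ s ∈ S₀, g = γ * s) :
    (RightCoset Γ →₀ R) →ₗ[R] (RightCoset (Γ.subgroupOf S₀) →₀ R) :=
  (Finsupp.domLCongr (cosetEquiv Γ S₀ hS).symm).toLinearMap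

theorem restrictCosets_single (s : S₀) (a : R) :
    restrictCosets R hS (Finsupp.single (RightCoset.mk Γ (s : G)) a) =
      Finsupp.single (RightCoset.mk _ s) a := by
  simp [restrictCosets, cosetEquiv_symm_mk]

theorem restrictCosets_translate (s : S₀) (f : RightCoset Γ →₀ R) :
    restrictCosets R hS (translate R Γ (s : G) f) =
      translate R (Γ.subgroupOf S₀) s (restrictCosets R hS f) := by
  induction f using finsupp_induction with
  | h0 => simp
  | hadd k l hk hl => simp only [map_add, hk, hl]
  | hs x b =>
    obtain ⟨t, ht⟩ := exists_rep hS x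
    rw [ht, translate_single, restrictCosets_single, translate_single,
      ← restrictCosets_single hS, Subgroup.coe_mul]

theorem restrictCosets_mem {f : RightCoset Γ →₀ R} (hf : f ∈ invariants R Γ) :
    restrictCosets R hS f ∈ invariants R (Γ.subgroupOf S₀) := by
  intro γ hγ
  have hγ' : translate R Γ (γ : G) f = f := hf _ hγ
  have h := restrictCosets_translate hS γ f
  rw [hγ'] at h
  exact h.symm

theorem restrictCosets_convolve {f : RightCoset Γ →₀ R} (hf : f ∈ invariants R Γ)
    (h : RightCoset Γ →₀ R) :
    restrictCosets R hS (convolve f h) =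
      convolve (restrictCosets R hS f) (restrictCosets R hS h) := by
  induction h using finsupp_induction with
  | h0 => simp [convolve_zero]
  | hadd k l hk hl => simp only [convolve_add, map_add, hk, hl]
  | hs x b =>
    obtain ⟨t, ht⟩ := exists_rep hS x
    rw [ht, convolve_single hf, map_smul, restrictCosets_translate, restrictCosets_single,
      convolve_single (restrictCosets_mem hS hf)]

/-- The embedding `ε : H(Γ, G) → H(Γ ∩ S₀, S₀)`, for `G = Γ S₀`: an element is written as
`∑ aᵢ Γ gᵢ` with all `gᵢ ∈ S₀` and sent to `∑ aᵢ (Γ ∩ S₀) gᵢ`. -/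
noncomputable def embedding (R : Type*) [CommRing R]
    (hS : ∀ g : G, ∃ γ ∈ Γ, ∃ s ∈ S₀, g = γ * s) : HeckeAlg R Γ →+* HeckeAlg R (Γ.subgroupOf S₀) where
  toFun X := ⟨restrictCosets R hS X.toFinsupp, restrictCosets_mem hS X.2⟩
  map_zero' := by
    apply toFinsupp_injective
    exact map_zero (restrictCosets R hS)
  map_add' X Y := by
    apply toFinsupp_injective
    exact map_add (restrictCosets R hS) X.toFinsupp Y.toFinsupp
  map_one' := by
    apply toFinsupp_injective
    exact restrictCosets_single hS 1 (1 : R)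
  map_mul' X Y := by
    apply toFinsupp_injective
    exact restrictCosets_convolve hS (toFinsupp_mem X) Y.toFinsupp

theorem embedding_injective (hS : ∀ g : G, ∃ γ ∈ Γ, ∃ s ∈ S₀, g = γ * s) :
    Function.Injective (embedding R hS) := by
  intro X Y h
  have h' : restrictCosets R hS X.toFinsupp = restrictCosets R hS Y.toFinsupp :=
    congrArg toFinsupp h
  exact toFinsupp_injective ((Finsupp.domLCongr (cosetEquiv Γ S₀ hS).symm).injective h')

end HeckeAlg

/-! ### The groups `GL_n(ℤ_p) ⊆ GL_n(ℚ_p)` and block parabolic subgroups -/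

namespace PadicGL

open Matrix

variable (p : ℕ) [Fact p.Prime]

/-- The maximal compact subgroup `Γ_n = GL_n(ℤ_p)` of `GL_n(ℚ_p)`. -/
noncomputable def integral (n : ℕ) : Subgroup (GL (Fin n) ℚ_[p]) :=
  (GeneralLinearGroup.map (n := Fin n) (PadicInt.Coe.ringHom (p := p))).range

/-- The subgroup of `GL_n(ℚ_p)` of all block upper triangular matrices; the blocks are the fibres
of `b`, in their order. -/
noncomputable def parabolic {n k : ℕ} (b : Fin n → Fin k) : Subgroup (GL (Fin n) ℚ_[p]) where
  carrier := {g | (g : Matrix (Fin n) (Fin n) ℚ_[p]).BlockTriangular b}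
  mul_mem' hg hh := by
    simpa using BlockTriangular.mul hg hh
  one_mem' := by simpa using blockTriangular_one
  inv_mem' {g} hg := by
    have : Invertible (g : Matrix (Fin n) (Fin n) ℚ_[p]) := Units.invertible g
    change ((g⁻¹ : GL (Fin n) ℚ_[p]) : Matrix (Fin n) (Fin n) ℚ_[p]).BlockTriangular b
    rw [GeneralLinearGroup.coe_inv]
    exact blockTriangular_inv_of_blockTriangular hg

/-- The group `Γ_P` of `ℤ_p`-points of a block parabolic subgroup `P`, as a subgroup of `P`. -/
noncomputable abbrev parabolicIntegral {n k : ℕ} (b : Fin n → Fin k) :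
    Subgroup (parabolic p b) :=
  (integral p n).subgroupOf (parabolic p b)

/-- The diagonal matrix with the given invertible entries. -/
noncomputable def diag {n : ℕ} (a : Fin n → ℚ_[p]ˣ) : GL (Fin n) ℚ_[p] where
  val := diagonal fun i => (a i : ℚ_[p])
  inv := diagonal fun i => ((a i)⁻¹ : ℚ_[p]ˣ)
  val_inv := by simp
  inv_val := by simp

theorem diag_mem_parabolic {n k : ℕ} (b : Fin n → Fin k) (a : Fin n → ℚ_[p]ˣ) :
    diag p a ∈ parabolic p b :=
  blockTriangular_diagonal _

variable {p}

theorem mem_integral_of_norm_le {n : ℕ} {g : GL (Fin n) ℚ_[p]}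
    (h : ∀ i j, ‖g i j‖ ≤ 1) (h' : ∀ i j, ‖(g⁻¹ : GL (Fin n) ℚ_[p]) i j‖ ≤ 1) :
    g ∈ integral p n := by
  have hinj : Function.Injective
      (fun M : Matrix (Fin n) (Fin n) ℤ_[p] => M.map (PadicInt.Coe.ringHom (p := p))) :=
    Matrix.map_injective Subtype.val_injective
  let A : Matrix (Fin n) (Fin n) ℤ_[p] := fun i j => ⟨g i j, h i j⟩
  let B : Matrix (Fin n) (Fin n) ℤ_[p] := fun i j => ⟨(g⁻¹ : GL (Fin n) ℚ_[p]) i j, h' i j⟩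
  have hA : A.map (PadicInt.Coe.ringHom (p := p)) = (g : Matrix (Fin n) (Fin n) ℚ_[p]) := rfl
  have hB : B.map (PadicInt.Coe.ringHom (p := p)) =
      ((g⁻¹ : GL (Fin n) ℚ_[p]) : Matrix (Fin n) (Fin n) ℚ_[p]) := rfl
  refine ⟨⟨A, B, hinj ?_, hinj ?_⟩, ?_⟩
  · simp only [Matrix.map_mul, hA, hB]
    rw [← GeneralLinearGroup.coe_mul, mul_inv_cancel]
    simp
  · simp only [Matrix.map_mul, hA, hB]
    rw [← GeneralLinearGroup.coe_mul, inv_mul_cancel]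
    simp
  · apply GeneralLinearGroup.ext
    intro i j
    rfl

/-- The principal congruence subgroup of level `p ^ k`. -/
noncomputable def congruence (p : ℕ) [Fact p.Prime] (n k : ℕ) : Subgroup (GL (Fin n) ℚ_[p]) :=
  (GeneralLinearGroup.map (n := Fin n) (PadicInt.toZModPow (p := p) k)).ker.map
    (GeneralLinearGroup.map (n := Fin n) (PadicInt.Coe.ringHom (p := p)))

theorem congruence_relIndex (n k : ℕ) :
    (congruence p n k).relIndex (integral p n) ≠ 0 := by
  have hinj : Function.Injective
      (GeneralLinearGroup.map (n := Fin n) (PadicInt.Coe.ringHom (p := p))) := by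
    intro x y h
    apply GeneralLinearGroup.ext
    intro i j
    have := congrArg (fun z : GL (Fin n) ℚ_[p] => z i j) h
    exact Subtype.val_injective this
  have : NeZero (p ^ k) := ⟨pow_ne_zero _ (Fact.out : p.Prime).ne_zero⟩
  rw [congruence, integral, MonoidHom.range_eq_map, Subgroup.relIndex_map_map_of_injective _ _ hinj,
    Subgroup.relIndex_top_right]
  exact Subgroup.FiniteIndex.index_ne_zero

theorem exists_pow_mul_le (n : ℕ) (g h : GL (Fin n) ℚ_[p]) :
    ∃ k : ℕ, ∀ i a b j, ‖(p : ℚ_[p]) ^ k * (h i a * g b j)‖ ≤ 1 := by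
  have hp : (1 : ℝ) < p := by exact_mod_cast (Fact.out : p.Prime).one_lt
  have key : ∀ x : Fin n × Fin n × Fin n × Fin n, ∃ k : ℕ, ∀ l ≥ k,
      ‖(p : ℚ_[p]) ^ l * (h x.1 x.2.1 * g x.2.2.1 x.2.2.2)‖ ≤ 1 := by
    intro x
    have ht : Filter.Tendsto (fun l : ℕ => ‖(p : ℚ_[p]) ^ l * (h x.1 x.2.1 * g x.2.2.1 x.2.2.2)‖)
        Filter.atTop (nhds 0) := by
      have h0 := (tendsto_pow_atTop_nhds_zero_of_lt_one (norm_nonneg (p : ℚ_[p]))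
        Padic.norm_p_lt_one).mul_const ‖h x.1 x.2.1 * g x.2.2.1 x.2.2.2‖
      simpa [norm_mul, norm_pow] using h0
    have := ht.eventually (Iic_mem_nhds (show (0 : ℝ) < 1 by norm_num))
    exact Filter.eventually_atTop.1 this
  choose K hK using key
  refine ⟨Finset.univ.sup K, fun i a b j => ?_⟩
  exact hK (i, a, b, j) _ (Finset.le_sup (Finset.mem_univ _))

theorem conj_norm_le {n k : ℕ} {g : GL (Fin n) ℚ_[p]}
    (hk : ∀ i a b j, ‖(p : ℚ_[p]) ^ k * ((g⁻¹ : GL (Fin n) ℚ_[p]) i a * g b j)‖ ≤ 1)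
    {x : GL (Fin n) ℚ_[p]} (hx : x ∈ congruence p n k) (i j : Fin n) :
    ‖(g⁻¹ * x * g : GL (Fin n) ℚ_[p]) i j‖ ≤ 1 := by
  obtain ⟨y, hy, rfl⟩ := hx
  have hdiv : ∀ a b, ∃ c : ℤ_[p], y a b = (1 : Matrix (Fin n) (Fin n) ℤ_[p]) a b + p ^ k * c := by
    intro a b
    have h1 := congrArg (fun z : GL (Fin n) (ZMod (p ^ k)) => z a b) (MonoidHom.mem_ker.1 hy)
    have h2 : PadicInt.toZModPow k (y a b - (1 : Matrix (Fin n) (Fin n) ℤ_[p]) a b) = 0 := by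
      have h1' : PadicInt.toZModPow k (y a b) = (1 : Matrix (Fin n) (Fin n) (ZMod (p ^ k))) a b :=
        h1
      rw [map_sub, h1', sub_eq_zero]
      by_cases hab : a = b <;> simp [Matrix.one_apply, hab]
    rw [← RingHom.mem_ker, PadicInt.ker_toZModPow, Ideal.mem_span_singleton] at h2
    obtain ⟨c, hc⟩ := h2
    exact ⟨c, by rw [← hc]; ring⟩
  choose c hc using hdiv
  have hM : ((GeneralLinearGroup.map (n := Fin n) (PadicInt.Coe.ringHom (p := p)) y :
      GL (Fin n) ℚ_[p]) : Matrix (Fin n) (Fin n) ℚ_[p]) =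
      1 + Matrix.of fun a b => (p : ℚ_[p]) ^ k * (c a b : ℚ_[p]) := by
    ext a b
    have : ((GeneralLinearGroup.map (n := Fin n) (PadicInt.Coe.ringHom (p := p)) y :
      GL (Fin n) ℚ_[p]) : Matrix (Fin n) (Fin n) ℚ_[p]) a b = ((y a b : ℤ_[p]) : ℚ_[p]) := rfl
    rw [this, hc a b]
    by_cases hab : a = b <;> simp [Matrix.one_apply, hab]
  have hentry : (g⁻¹ * (GeneralLinearGroup.map (n := Fin n) (PadicInt.Coe.ringHom (p := p)) y) * g :
      GL (Fin n) ℚ_[p]) i j = (1 : Matrix (Fin n) (Fin n) ℚ_[p]) i j +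
      ∑ b, ∑ a, (c a b : ℚ_[p]) * ((p : ℚ_[p]) ^ k * ((g⁻¹ : GL (Fin n) ℚ_[p]) i a * g b j)) := by
    have h3 : ((g⁻¹ * (GeneralLinearGroup.map (n := Fin n) (PadicInt.Coe.ringHom (p := p)) y) * g :
      GL (Fin n) ℚ_[p]) : Matrix (Fin n) (Fin n) ℚ_[p]) = 1 +
        ((g⁻¹ : GL (Fin n) ℚ_[p]) : Matrix (Fin n) (Fin n) ℚ_[p]) *
          (Matrix.of fun a b => (p : ℚ_[p]) ^ k * (c a b : ℚ_[p])) *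
          (g : Matrix (Fin n) (Fin n) ℚ_[p]) := by
      rw [GeneralLinearGroup.coe_mul, GeneralLinearGroup.coe_mul, hM, mul_add, add_mul, mul_one,
        ← GeneralLinearGroup.coe_mul, inv_mul_cancel, GeneralLinearGroup.coe_one]
    rw [h3, Matrix.add_apply, Matrix.mul_apply]
    congr 1
    refine Finset.sum_congr rfl fun b _ => ?_
    rw [Matrix.mul_apply, Finset.sum_mul]
    refine Finset.sum_congr rfl fun a _ => ?_
    rw [Matrix.of_apply]
    ring
  rw [hentry]
  refine (PadicInt.subring p).add_mem ?_ ?_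
  · by_cases hij : i = j
    · simp [hij, Matrix.one_apply, PadicInt.subring]
    · simp [hij, PadicInt.subring]
  · refine (PadicInt.subring p).sum_mem fun b _ => (PadicInt.subring p).sum_mem fun a _ => ?_
    exact (PadicInt.subring p).mul_mem (c a b).2 (hk i a b j)

theorem relIndex_conj_ne_zero {n : ℕ} (g : GL (Fin n) ℚ_[p]) :
    (ConjAct.toConjAct g • integral p n).relIndex (integral p n) ≠ 0 := by
  obtain ⟨k, hk⟩ := exists_pow_mul_le n g g⁻¹
  have hle : congruence p n k ≤ ConjAct.toConjAct g • integral p n := by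
    intro x hx
    rw [Subgroup.mem_pointwise_smul_iff_inv_smul_mem, ConjAct.smul_def]
    simp only [map_inv, inv_inv, ConjAct.ofConjAct_toConjAct]
    refine mem_integral_of_norm_le (conj_norm_le hk hx) ?_
    have : (g⁻¹ * x * g)⁻¹ = g⁻¹ * x⁻¹ * g := by group
    rw [this]
    exact conj_norm_le hk ((congruence p n k).inv_mem hx)
  exact ne_zero_of_dvd_ne_zero (congruence_relIndex n k)
    (Subgroup.relIndex_dvd_of_le_left _ hle)

theorem conj_relIndex_ne_zero {n : ℕ} (g : GL (Fin n) ℚ_[p]) :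
    (integral p n).relIndex (ConjAct.toConjAct g • integral p n) ≠ 0 := by
  have h := relIndex_conj_ne_zero (p := p) g⁻¹
  rw [← Subgroup.relIndex_pointwise_smul (ConjAct.toConjAct g), smul_smul, ← map_mul,
    mul_inv_cancel, map_one, one_smul] at h
  exact h

/-- `(GL_n(ℤ_p), GL_n(ℚ_p))` is a Hecke pair. -/
instance (n : ℕ) :
    IsHeckeTriple (⊤ : Submonoid (GL (Fin n) ℚ_[p])) (integral p n) (integral p n) :=
  IsHeckeTriple.of_diagonal le_top fun g _ =>
    ⟨relIndex_conj_ne_zero g, conj_relIndex_ne_zero g⟩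

theorem conj_subgroupOf {G : Type*} [Group G] (Γ P : Subgroup G) (g : P) :
    ConjAct.toConjAct g • Γ.subgroupOf P = (ConjAct.toConjAct (g : G) • Γ).subgroupOf P := by
  ext x
  rw [Subgroup.mem_pointwise_smul_iff_inv_smul_mem, Subgroup.mem_subgroupOf,
    Subgroup.mem_subgroupOf, Subgroup.mem_pointwise_smul_iff_inv_smul_mem]
  simp [ConjAct.smul_def]

/-- `(Γ_P, P)` is a Hecke pair for every block parabolic subgroup `P` of `GL_n(ℚ_p)`. -/
instance {n k : ℕ} (b : Fin n → Fin k) :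
    IsHeckeTriple (⊤ : Submonoid (parabolic p b)) (parabolicIntegral p b)
      (parabolicIntegral p b) :=
  IsHeckeTriple.of_diagonal le_top fun g _ => by
    change Subgroup.Commensurable (ConjAct.toConjAct g • parabolicIntegral p b) _
    rw [parabolicIntegral, conj_subgroupOf]
    have aux : ∀ A B : Subgroup (GL (Fin n) ℚ_[p]), A.relIndex B ≠ 0 →
        (A.subgroupOf (parabolic p b)).relIndex (B.subgroupOf (parabolic p b)) ≠ 0 := by
      intro A B h
      rw [Subgroup.subgroupOf, Subgroup.subgroupOf, Subgroup.relIndex_comap]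
      refine mt (Subgroup.relIndex_eq_zero_of_le_right ?_) h
      exact Subgroup.map_comap_le _ _
    exact ⟨aux _ _ (relIndex_conj_ne_zero (g : GL (Fin n) ℚ_[p])),
      aux _ _ (conj_relIndex_ne_zero (g : GL (Fin n) ℚ_[p]))⟩

/-! ### Iwasawa decomposition -/

theorem exists_clear_column {n : ℕ} (M : Matrix (Fin (n + 1)) (Fin (n + 1)) ℚ_[p]) :
    ∃ E : Matrix (Fin (n + 1)) (Fin (n + 1)) ℤ_[p], IsUnit E.det ∧
      ∀ i : Fin n, (E.map (PadicInt.Coe.ringHom (p := p)) * M) i.succ 0 = 0 := by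
  obtain ⟨i₀, hi₀⟩ := Finite.exists_max fun i => ‖M i 0‖
  let σ : Equiv.Perm (Fin (n + 1)) := Equiv.swap 0 i₀
  have hq : ∀ i : Fin (n + 1), ‖M (σ i) 0 / M i₀ 0‖ ≤ 1 := by
    intro i
    rw [norm_div]
    exact div_le_one_of_le₀ (hi₀ _) (norm_nonneg _)
  let q : Fin (n + 1) → ℤ_[p] := fun i => ⟨M (σ i) 0 / M i₀ 0, hq i⟩
  let L : Matrix (Fin (n + 1)) (Fin (n + 1)) ℤ_[p] :=
    Matrix.of fun i j => if i = j then 1 else if j = 0 then - q i else 0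
  have hL : L.det = 1 := by
    rw [det_of_isLowerTriangular L]
    · simp [L]
    · intro i j hij
      have hij' : i < j := hij
      have h1 : i ≠ j := hij'.ne
      have h2 : j ≠ 0 := (Fin.pos_of_ne_zero (by
        rintro rfl
        exact absurd hij' (Fin.not_lt_zero _))).ne'
      simp [L, h1, h2]
  refine ⟨L * σ.permMatrix ℤ_[p], ?_, ?_⟩
  · rw [det_mul, hL, one_mul, det_permutation]
    exact (Units.isUnit (Equiv.Perm.sign σ)).map (Int.castRingHom ℤ_[p])
  · intro i
    have hperm : (σ.permMatrix ℤ_[p]).map (PadicInt.Coe.ringHom (p := p)) = σ.permMatrix ℚ_[p] := by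
      ext a b
      simp [Equiv.Perm.permMatrix, PEquiv.toMatrix_apply, apply_ite]
    rw [Matrix.map_mul, hperm, Matrix.mul_assoc]
    have hrow : ∀ a, (σ.permMatrix ℚ_[p] * M) a 0 = M (σ a) 0 := by
      intro a
      rw [Equiv.Perm.permMatrix, PEquiv.toMatrix_toPEquiv_mul]
      rfl
    rw [Matrix.mul_apply, Fin.sum_univ_succ]
    simp only [hrow]
    have hσ0 : σ 0 = i₀ := Equiv.swap_apply_left _ _
    have hsum : ∑ j : Fin n, (L.map (PadicInt.Coe.ringHom (p := p))) i.succ j.succ *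
        M (σ j.succ) 0 = M (σ i.succ) 0 := by
      rw [Finset.sum_eq_single i]
      · simp [L]
      · intro j _ hj
        have : i ≠ j := fun h => hj h.symm
        simp [L, this]
      · simp
    rw [hsum, hσ0]
    have hL0 : (L.map (PadicInt.Coe.ringHom (p := p))) i.succ 0 = - (M (σ i.succ) 0 / M i₀ 0) := by
      simp only [Matrix.map_apply, L, Matrix.of_apply, Fin.succ_ne_zero, if_false, if_true, map_neg]
      rfl
    rw [hL0]
    by_cases h0 : M i₀ 0 = 0
    · have : M (σ i.succ) 0 = 0 := by
        have := hi₀ (σ i.succ)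
        simpa [h0] using this
      simp [this]
    · field_simp
      ring

theorem exists_triangular : ∀ (n : ℕ) (M : Matrix (Fin n) (Fin n) ℚ_[p]),
    ∃ E : Matrix (Fin n) (Fin n) ℤ_[p], IsUnit E.det ∧
      (E.map (PadicInt.Coe.ringHom (p := p)) * M).BlockTriangular id := by
  intro n
  induction n with
  | zero =>
    intro M
    exact ⟨1, by simp, fun i => i.elim0⟩
  | succ n ih =>
    intro M
    obtain ⟨E, hE, hM⟩ := exists_clear_column M
    obtain ⟨F, hF, hT⟩ := ih ((E.map (PadicInt.Coe.ringHom (p := p)) * M).submatrix Fin.succ Fin.succ)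
    let F' : Matrix (Fin (n + 1)) (Fin (n + 1)) ℤ_[p] :=
      Matrix.of (Fin.cons (Fin.cons 1 0) fun i => Fin.cons 0 (F i))
    have hF' : F'.det = F.det := by
      rw [det_succ_column_zero, Fin.sum_univ_succ]
      have : F'.submatrix (Fin.succAbove 0) Fin.succ = F := by
        ext i j
        simp [F']
      rw [this]
      simp [F']
    refine ⟨F' * E, ?_, ?_⟩
    · rw [det_mul, hF']
      exact hF.mul hE
    · intro i j hij
      change j < i at hij
      rw [Matrix.map_mul, Matrix.mul_assoc]
      set N := E.map (PadicInt.Coe.ringHom (p := p)) * M with hN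
      obtain ⟨i, rfl⟩ : ∃ i', i = Fin.succ i' :=
        Fin.exists_succ_eq.2 (Fin.pos_of_ne_zero (by
          rintro rfl
          exact absurd hij (Fin.not_lt_zero _))).ne' |>.imp fun _ h => h.symm
      rw [Matrix.mul_apply, Fin.sum_univ_succ]
      have hz : (F'.map (PadicInt.Coe.ringHom (p := p))) i.succ 0 = 0 := by simp [F']
      rw [hz, zero_mul, zero_add]
      refine Fin.cases (fun _ => ?_) (fun j hij => ?_) j hij
      · simp [hM]
      · have := hT (show (j : Fin n) < i from Fin.succ_lt_succ_iff.1 hij)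
        rw [Matrix.mul_apply] at this
        simpa [F'] using this

theorem iwasawa {n k : ℕ} {b : Fin n → Fin k} (hb : Monotone b) (g : GL (Fin n) ℚ_[p]) :
    ∃ γ ∈ integral p n, ∃ s ∈ parabolic p b, g = γ * s := by
  obtain ⟨E, hE, hT⟩ := exists_triangular n (g : Matrix (Fin n) (Fin n) ℚ_[p])
  let e : GL (Fin n) ℚ_[p] :=
    GeneralLinearGroup.map (PadicInt.Coe.ringHom (p := p)) (GeneralLinearGroup.mk'' E hE)
  have he : (e : Matrix (Fin n) (Fin n) ℚ_[p]) = E.map (PadicInt.Coe.ringHom (p := p)) := rfl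
  refine ⟨e⁻¹, (integral p n).inv_mem ⟨_, rfl⟩, e * g, ?_, by group⟩
  intro i j hij
  rw [GeneralLinearGroup.coe_mul, he]
  exact hT (hb.reflect_lt hij)

end PadicGL

/-! ### The Hecke algebras `H_4` and `H_{1,2,1}` and their standard elements -/

namespace GL4Hecke

open PadicGL Polynomial

variable (p : ℕ) [Fact p.Prime]

/-- The prime `p` as an element of `ℚ_p^×`. -/
noncomputable def pU : ℚ_[p]ˣ :=
  Units.mk0 (p : ℚ_[p]) (Nat.cast_ne_zero.2 (Fact.out : p.Prime).ne_zero)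

/-- The blocks `{0}, {1, 2}, {3}` of sizes `1, 2, 1`. -/
def blocks : Fin 4 → Fin 3 := ![0, 1, 1, 2]

theorem blocks_monotone : Monotone blocks := by decide

/-- The parabolic subgroup `P_{1,2,1}` of `GL_4(ℚ_p)`. -/
noncomputable abbrev P121 : Subgroup (Matrix.GeneralLinearGroup (Fin 4) ℚ_[p]) :=
  parabolic p blocks

variable (R : Type*) [CommRing R]

/-- The Hecke algebra `H_4 = H(GL_4(ℤ_p), GL_4(ℚ_p))`. -/
abbrev H4 : Type _ := HeckeAlg R (integral p 4)

/-- The parabolic Hecke algebra `H_{1,2,1} = H(Γ_{1,2,1}, P_{1,2,1})`. -/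
abbrev H121 : Type _ := HeckeAlg R (parabolicIntegral p blocks)

/-- `T(a, b, c, d) = Γ_4 diag(a, b, c, d) Γ_4`. -/
noncomputable def T (a b c d : ℚ_[p]ˣ) : H4 p R :=
  HeckeAlg.doubleCoset R (integral p 4) (diag p ![a, b, c, d])

/-- `T₀(a, b, c, d) = Γ_{1,2,1} diag(a, b, c, d) Γ_{1,2,1}`. -/
noncomputable def T₀ (a b c d : ℚ_[p]ˣ) : H121 p R :=
  HeckeAlg.doubleCoset R (parabolicIntegral p blocks)
    ⟨diag p ![a, b, c, d], diag_mem_parabolic p blocks _⟩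

/-- The embedding `ε : H_4 → H_{1,2,1}`. -/
noncomputable def ε : H4 p R →+* H121 p R :=
  HeckeAlg.embedding R (iwasawa (p := p) blocks_monotone)

/-- The standard Hecke polynomial `1 - T₁ t + p T₂ t² - p³ T₃ t³ + p⁶ Δ t⁴` with
`T₁ = T(1,1,1,p)`, `T₂ = T(1,1,p,p)`, `T₃ = T(1,p,p,p)` and `Δ = T(p,p,p,p)`. -/
noncomputable def Q4 : (H4 p R)[X] :=
  1 - C (T p R 1 1 1 (pU p)) * X
    + C ((p : H4 p R) * T p R 1 1 (pU p) (pU p)) * X ^ 2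
    - C ((p : H4 p R) ^ 3 * T p R 1 (pU p) (pU p) (pU p)) * X ^ 3
    + C ((p : H4 p R) ^ 6 * T p R (pU p) (pU p) (pU p) (pU p)) * X ^ 4

/-- `Λ₋^{1,3} = T₀(p, 1, 1, 1)`. -/
noncomputable def LambdaMinus13 : H121 p R := T₀ p R (pU p) 1 1 1

/-- `Λ₊^{3,1} = T₀(1, 1, 1, p)`. -/
noncomputable def LambdaPlus31 : H121 p R := T₀ p R 1 1 1 (pU p)

/-- `X₁ = T₀(1, 1, p, 1)`. -/
noncomputable def X₁ : H121 p R := T₀ p R 1 1 (pU p) 1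

/-- `X₂ = T₀(1, p, p, 1)`. -/
noncomputable def X₂ : H121 p R := T₀ p R 1 (pU p) (pU p) 1

end GL4Hecke

/-! For a set S of positions let D_S be the diagonal matrix with p at the positions in S and 1
elsewhere, and let E(S) be the formal sum of the cosets of the matrices D_S(1+N), where N has
entries in F_p (lifted to {0, …, p-1}) at the positions (i,j) with i ∉ S, j ∈ S, i < j, and zeros
elsewhere. These are row echelon representatives: the Γ-cosets in Γ D_S Γ are represented exactly
once each by the D_T(1+N) with |T| = |S| (`exists_rep_eq`, `rep_cellLift_injective`), and for a
parabolic subgroup T is further restricted by its agreement with S at the blocks of size one.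

All representatives are upper triangular, so they lie in P, and ε only reinterprets their cosets.
With positions counted from 0, ε(T_k) is the sum of the E(S) with |S| = k, and ε(Δ) = E({0,1,2,3});
the factors on the right are Λ₋ = E({0}), X₁ = E({1}) + E({2}), X₂ = E({1,2}), Λ₊ = E({3}).

The only multiplication rule needed is E(S)·E(T) = p^(|S||T|) E(S ∪ T) whenever S lies entirely to
the left of T (`mulEchelonSum_echelonSum`). Expanding the factorisation produces every subset S of
size k exactly once. The powers of p from this rule, with the explicit p before X₂, add up to
k(k-1)/2, the exponents 0, 1, 3, 6 of the Hecke polynomial.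

E({1}) and E({2}) are not invariant under Γ_{1,2,1} separately. The rule is therefore stated for a
linear operator on all formal sums, which agrees with the Hecke product on invariant left factors
(`convolve_echelonSum`). -/

namespace Matrix

/-! ### Matrices with prescribed support and echelon cells -/

variable {n : ℕ} {A B : Type*} [CommRing A] [CommRing B]

/-- The matrices whose entries vanish outside the positions given by `r`. -/
def supported (A : Type*) [CommRing A] (r : Fin n → Fin n → Prop) :
    AddSubgroup (Matrix (Fin n) (Fin n) A) where
  carrier := {N | ∀ i j, ¬ r i j → N i j = 0}
  zero_mem' _ _ _ := rfl
  add_mem' hM hN i j h := by rw [add_apply, hM i j h, hN i j h, add_zero]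
  neg_mem' hN i j h := by rw [neg_apply, hN i j h, neg_zero]

/-- The positions of the free entries of a reduced row echelon matrix without pivots in the
columns of `S`. -/
def cellRel (S : Finset (Fin n)) (i j : Fin n) : Prop := i ∉ S ∧ j ∈ S ∧ i < j

/-- The matrices `N` for which `1 + N` is a reduced row echelon matrix, after the rows in `S` are
removed. -/
abbrev cell (A : Type*) [CommRing A] (S : Finset (Fin n)) :
    AddSubgroup (Matrix (Fin n) (Fin n) A) := supported A (cellRel S)

theorem map_mem_supported {r : Fin n → Fin n → Prop} {N : Matrix (Fin n) (Fin n) A}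
    (hN : N ∈ supported A r) {f : A → B} (hf : f 0 = 0) : N.map f ∈ supported B r :=
  fun i j h => by rw [map_apply, hN i j h, hf]

theorem mul_eq_zero_of_supported {r q : Fin n → Fin n → Prop} {M N : Matrix (Fin n) (Fin n) A}
    (hM : M ∈ supported A r) (hN : N ∈ supported A q) (h : ∀ i j k, r i j → ¬ q j k) :
    M * N = 0 := by
  ext i k
  rw [mul_apply]
  refine Finset.sum_eq_zero fun j _ => ?_
  by_cases hr : r i j
  · rw [hN j k (h i j k hr), mul_zero]
  · rw [hM i j hr, zero_mul]

theorem mul_mem_supported {r q s : Fin n → Fin n → Prop} {M N : Matrix (Fin n) (Fin n) A}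
    (hM : M ∈ supported A r) (hN : N ∈ supported A q) (h : ∀ i j k, r i j → q j k → s i k) :
    M * N ∈ supported A s := by
  intro i k hs
  rw [mul_apply]
  refine Finset.sum_eq_zero fun j _ => ?_
  by_cases hr : r i j
  · rw [hN j k fun hq => hs (h i j k hr hq), mul_zero]
  · rw [hM i j hr, zero_mul]

theorem supported_mono {r q : Fin n → Fin n → Prop} (h : ∀ i j, r i j → q i j) :
    supported A r ≤ supported A q :=
  fun _ hN i j hq => hN i j fun hr => hq (h i j hr)

theorem cell_mul_cell {S : Finset (Fin n)} {M N : Matrix (Fin n) (Fin n) A}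
    (hM : M ∈ cell A S) (hN : N ∈ cell A S) : M * N = 0 :=
  mul_eq_zero_of_supported hM hN fun _ _ _ h h' => h'.1 h.2.1

open Classical in
/-- The matrix that agrees with `N` at the positions given by `r` and vanishes elsewhere. -/
noncomputable def restrict (r : Fin n → Fin n → Prop) (N : Matrix (Fin n) (Fin n) A) :
    Matrix (Fin n) (Fin n) A :=
  of fun i j => if r i j then N i j else 0

theorem restrict_apply_of_pos {r : Fin n → Fin n → Prop} (N : Matrix (Fin n) (Fin n) A)
    {i j : Fin n} (h : r i j) : restrict r N i j = N i j := by simp [restrict, h]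

theorem restrict_apply_of_neg {r : Fin n → Fin n → Prop} (N : Matrix (Fin n) (Fin n) A)
    {i j : Fin n} (h : ¬ r i j) : restrict r N i j = 0 := by simp [restrict, h]

theorem restrict_mem (r : Fin n → Fin n → Prop) (N : Matrix (Fin n) (Fin n) A) :
    restrict r N ∈ supported A r := fun _ _ h => restrict_apply_of_neg N h

theorem restrict_mem_of_mem {r q s : Fin n → Fin n → Prop} {N : Matrix (Fin n) (Fin n) A}
    (hN : N ∈ supported A q) (h : ∀ i j, q i j → r i j → s i j) :
    restrict r N ∈ supported A s := by
  intro i j hs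
  by_cases hr : r i j
  · rw [restrict_apply_of_pos N hr, hN i j fun hq => hs (h i j hq hr)]
  · exact restrict_apply_of_neg N hr

theorem restrict_add (r : Fin n → Fin n → Prop) (M N : Matrix (Fin n) (Fin n) A) :
    restrict r (M + N) = restrict r M + restrict r N := by
  ext i j
  by_cases h : r i j <;> simp [restrict, h]

theorem restrict_eq_self {r q : Fin n → Fin n → Prop} {N : Matrix (Fin n) (Fin n) A}
    (hN : N ∈ supported A q) (h : ∀ i j, q i j → r i j) : restrict r N = N := by
  ext i j
  by_cases hr : r i j
  · exact restrict_apply_of_pos N hr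
  · rw [restrict_apply_of_neg N hr, hN i j fun hq => hr (h i j hq)]

theorem restrict_eq_zero {r q : Fin n → Fin n → Prop} {N : Matrix (Fin n) (Fin n) A}
    (hN : N ∈ supported A q) (h : ∀ i j, q i j → ¬ r i j) : restrict r N = 0 := by
  ext i j
  by_cases hr : r i j
  · rw [restrict_apply_of_pos N hr, hN i j fun hq => h i j hq hr, zero_apply]
  · exact restrict_apply_of_neg N hr

theorem restrict_map (r : Fin n → Fin n → Prop) (N : Matrix (Fin n) (Fin n) A) {f : A → B}
    (hf : f 0 = 0) : (restrict r N).map f = restrict r (N.map f) := by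
  ext i j
  by_cases h : r i j <;> simp [restrict, h, hf]

noncomputable instance [Finite A] (r : Fin n → Fin n → Prop) : Fintype (supported A r) :=
  Fintype.ofFinite _

theorem natCard_supported [Finite A] (r : Fin n → Fin n → Prop) :
    Nat.card (supported A r) = Nat.card A ^ Nat.card {x : Fin n × Fin n // r x.1 x.2} := by
  classical
  rw [← Nat.card_fun]
  refine Nat.card_congr
    { toFun := fun N x => N.1 x.1.1 x.1.2
      invFun := fun f => ⟨of fun i j => if h : r i j then f ⟨(i, j), h⟩ else 0, fun i j h => by
        simp [h]⟩
      left_inv := fun N => ?_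
      right_inv := fun f => ?_ }
  · ext i j
    by_cases h : r i j
    · simp [h]
    · simp [h, N.2 i j h]
  · ext x
    simp [x.2]

/-- The block of positions `S × T`. -/
def rectRel (S T : Finset (Fin n)) (i j : Fin n) : Prop := i ∈ S ∧ j ∈ T

theorem natCard_rect [Finite A] (S T : Finset (Fin n)) :
    Nat.card (supported A (rectRel S T)) = Nat.card A ^ (S.card * T.card) := by
  rw [natCard_supported]
  congr 1
  have e : {x : Fin n × Fin n // rectRel S T x.1 x.2} ≃ (S ×ˢ T : Finset (Fin n × Fin n)) :=
    Equiv.subtypeEquivRight fun x => by simp [rectRel]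
  rw [Nat.card_congr e, Nat.card_eq_fintype_card, Fintype.card_coe, Finset.card_product]

/-! ### The product of two echelon matrices -/

section Shear

variable {S T : Finset (Fin n)}

/-- The free entries of the product of two echelon matrices, for `S` to the left of `T`. -/
noncomputable def cellMul (S T : Finset (Fin n)) (N M : Matrix (Fin n) (Fin n) A) :
    Matrix (Fin n) (Fin n) A :=
  N + (M - restrict (rectRel S T) M) + N * restrict (rectRel S T) M

theorem cellMul_map (N M : Matrix (Fin n) (Fin n) A) (f : A →+* B) :
    (cellMul S T N M).map f = cellMul S T (N.map f) (M.map f) := by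
  simp [cellMul, Matrix.map_add, Matrix.map_sub, Matrix.map_mul, restrict_map]

theorem sub_restrict_mem {M : Matrix (Fin n) (Fin n) A}
    (hM : M ∈ cell A T) : M - restrict (rectRel S T) M ∈
      supported A fun i j => i ∉ S ∧ cellRel T i j := by
  intro i j h
  rw [sub_apply]
  by_cases hr : rectRel S T i j
  · rw [restrict_apply_of_pos M hr, sub_self]
  · rw [restrict_apply_of_neg M hr, hM i j, sub_zero]
    intro hc
    exact h ⟨fun hi => hr ⟨hi, hc.2.1⟩, hc⟩

theorem cellMul_mem (hST : ∀ s ∈ S, ∀ t ∈ T, s < t) {N M : Matrix (Fin n) (Fin n) A}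
    (hN : N ∈ cell A S) (hM : M ∈ cell A T) : cellMul S T N M ∈ cell A (S ∪ T) := by
  -- A nonzero row of N lies to the left of some column in S, and all of S lies to the left of T.
  have hT : ∀ i j, cellRel S i j → i ∉ T := fun i j h hi =>
    absurd (hST j h.2.1 i hi) (not_lt.2 h.2.2.le)
  refine add_mem (add_mem ?_ ?_) ?_
  · exact supported_mono (fun i j h => ⟨by simp [h.1, hT i j h], by simp [h.2.1], h.2.2⟩) hN
  · exact supported_mono (fun i j h => ⟨by simp [h.1, h.2.1], by simp [h.2.2.1], h.2.2.2⟩)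
      (sub_restrict_mem hM)
  · exact mul_mem_supported hN (restrict_mem _ M) fun i j k h h' =>
      ⟨by simp [h.1, hT i j h], by simp [h'.2], h.2.2.trans (hST j h'.1 k h'.2)⟩

/-- Write F for the S × T block of M and K for `cellMul S T N M`. Then F K = 0, because the columns
of F lie in T while the rows of K avoid T. Also N M = N F, because the columns of N lie in S while
the rows of M - F avoid S. Both sides are thus 1 + N + M + N F. The factor 1 + F on the left is what
a right coset later absorbs. -/
theorem one_add_mul_one_add (hST : ∀ s ∈ S, ∀ t ∈ T, s < t) {N M : Matrix (Fin n) (Fin n) A}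
    (hN : N ∈ cell A S) (hM : M ∈ cell A T) :
    (1 + N) * (1 + M) = (1 + restrict (rectRel S T) M) * (1 + cellMul S T N M) := by
  have h1 : restrict (rectRel S T) M * cellMul S T N M = 0 :=
    mul_eq_zero_of_supported (restrict_mem _ M) (cellMul_mem hST hN hM) fun i j k h h' =>
      h'.1 (Finset.mem_union_right _ h.2)
  have h2 : N * M = N * restrict (rectRel S T) M := by
    rw [← sub_eq_zero, ← mul_sub]
    exact mul_eq_zero_of_supported hN (sub_restrict_mem hM) fun i j k h h' => h'.1 h.2.1
  rw [mul_add, mul_one, add_mul, one_mul, h2, mul_add, mul_one, add_mul, one_mul, h1, cellMul]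
  abel

/-- Multiplication of echelon matrices, as a bijection on the free entries. -/
noncomputable def cellMulEquiv (A : Type*) [CommRing A] (hST : ∀ s ∈ S, ∀ t ∈ T, s < t) :
    cell A S × cell A T ≃ cell A (S ∪ T) × supported A (rectRel S T) := by
  have hdisj : ∀ j ∈ S, j ∉ T := fun j hj hj' => lt_irrefl j (hST j hj j hj')
  -- F has rows only in S, so K F sees only the columns of K in S. These are the matrix N to be
  -- recovered, whence K F = N F.
  have key : ∀ (K F : Matrix (Fin n) (Fin n) A), F ∈ supported A (rectRel S T) →
      K ∈ cell A (S ∪ T) → restrict (fun _ j => j ∈ S) K * F = K * F := by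
    intro K F hF hK
    ext i k
    rw [mul_apply, mul_apply]
    refine Finset.sum_congr rfl fun j _ => ?_
    by_cases hj : j ∈ S
    · rw [restrict_apply_of_pos (r := fun _ j => j ∈ S) K hj]
    · rw [hF j k fun h => hj h.1, mul_zero, mul_zero]
  have hKF : ∀ (K F : Matrix (Fin n) (Fin n) A), F ∈ supported A (rectRel S T) →
      K ∈ cell A (S ∪ T) → K * F ∈ supported A fun i j => i ∉ S ∧ cellRel T i j := by
    intro K F hF hK
    refine mul_mem_supported hK hF fun i j k h h' => ⟨?_, ?_, h'.2, ?_⟩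
    · exact fun hi => h.1 (Finset.mem_union_left _ hi)
    · exact fun hi => h.1 (Finset.mem_union_right _ hi)
    · exact h.2.2.trans (hST j h'.1 k h'.2)
  have hKT : ∀ K ∈ cell A (S ∪ T), restrict (fun _ j => j ∈ T) K ∈
      supported A fun i j => i ∉ S ∧ cellRel T i j := fun K hK =>
    restrict_mem_of_mem hK fun i j h hj => ⟨fun hi => h.1 (Finset.mem_union_left _ hi),
      fun hi => h.1 (Finset.mem_union_right _ hi), hj, h.2.2⟩
  exact
  { toFun := fun x => (⟨cellMul S T x.1.1 x.2.1, cellMul_mem hST x.1.2 x.2.2⟩,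
      ⟨restrict (rectRel S T) x.2.1, restrict_mem _ _⟩)
    -- Solving K = N + (M - F) + N F by columns: those in S give N, and those in T give M - F + N F,
    -- so M is the T-part of K, minus K F, plus F.
    invFun := fun y => (⟨restrict (fun _ j => j ∈ S) y.1.1,
        restrict_mem_of_mem y.1.2 fun i j h hj =>
          ⟨fun hi => h.1 (Finset.mem_union_left _ hi), hj, h.2.2⟩⟩,
      ⟨restrict (fun _ j => j ∈ T) y.1.1 - y.1.1 * y.2.1 + y.2.1, by
        refine add_mem (sub_mem ?_ ?_) ?_
        · exact supported_mono (fun i j h => h.2) (hKT _ y.1.2)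
        · exact supported_mono (fun i j h => h.2) (hKF _ _ y.2.2 y.1.2)
        · exact supported_mono (fun i j h => ⟨hdisj i h.1, h.2, hST i h.1 j h.2⟩) y.2.2⟩)
    left_inv := by
      rintro ⟨⟨N, hN⟩, ⟨M, hM⟩⟩
      have hK := cellMul_mem hST hN hM
      have hF := restrict_mem (rectRel S T) M
      have hNF : N * restrict (rectRel S T) M ∈ supported A fun i j => i ∉ S ∧ j ∈ T :=
        mul_mem_supported hN hF fun i j k h h' => ⟨h.1, h'.2⟩
      have hM' := sub_restrict_mem (S := S) hM
      have h1 : restrict (fun _ j => j ∈ S) (cellMul S T N M) = N := by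
        rw [cellMul, restrict_add, restrict_add, restrict_eq_self hN fun i j h => h.2.1,
          restrict_eq_zero hM' fun i j h hj => hdisj j hj h.2.2.1,
          restrict_eq_zero hNF fun i j h hj => hdisj j hj h.2, add_zero, add_zero]
      have h2 : restrict (fun _ j => j ∈ T) (cellMul S T N M) =
          M - restrict (rectRel S T) M + N * restrict (rectRel S T) M := by
        rw [cellMul, restrict_add, restrict_add,
          restrict_eq_zero hN fun i j h hj => hdisj j h.2.1 hj,
          restrict_eq_self hM' fun i j h => h.2.2.1,
          restrict_eq_self hNF fun i j h => h.2, zero_add]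
      refine Prod.ext (Subtype.ext h1) (Subtype.ext ?_)
      change restrict (fun _ j => j ∈ T) (cellMul S T N M) -
        cellMul S T N M * restrict (rectRel S T) M + restrict (rectRel S T) M = M
      rw [← key _ _ hF hK, h1, h2]
      abel
    right_inv := by
      rintro ⟨⟨K, hK⟩, ⟨F, hF⟩⟩
      have h1 : restrict (rectRel S T) (restrict (fun _ j => j ∈ T) K - K * F + F) = F := by
        rw [restrict_add, restrict_eq_self hF fun i j h => h,
          restrict_eq_zero (sub_mem (hKT K hK) (hKF K F hF hK)) fun i j h h' => h.1 h'.1, zero_add]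
      refine Prod.ext (Subtype.ext ?_) (Subtype.ext h1)
      change cellMul S T (restrict (fun _ j => j ∈ S) K)
        (restrict (fun _ j => j ∈ T) K - K * F + F) = K
      rw [cellMul, h1, key K F hF hK]
      have h3 : restrict (fun _ j => j ∈ S) K + restrict (fun _ j => j ∈ T) K = K := by
        ext i j
        rw [add_apply]
        by_cases hS : j ∈ S
        · rw [restrict_apply_of_pos (r := fun _ j => j ∈ S) K hS,
            restrict_apply_of_neg (r := fun _ j => j ∈ T) K (hdisj j hS), add_zero]
        · rw [restrict_apply_of_neg (r := fun _ j => j ∈ S) K hS, zero_add]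
          by_cases hT : j ∈ T
          · exact restrict_apply_of_pos (r := fun _ j => j ∈ T) K hT
          · rw [restrict_apply_of_neg (r := fun _ j => j ∈ T) K hT, hK i j]
            exact fun h => (Finset.mem_union.1 h.2.1).elim hS hT
      refine Eq.trans ?_ h3
      abel }

theorem cellMulEquiv_fst (hST : ∀ s ∈ S, ∀ t ∈ T, s < t) (x : cell A S × cell A T) :
    ((cellMulEquiv A hST x).1 : Matrix (Fin n) (Fin n) A) = cellMul S T x.1.1 x.2.1 := rfl

/-- By the bijection (N, M) ↔ (K, F), each K arises once for every block F of |S||T| free entries.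
This is the source of the powers of p. -/
theorem sum_cellMul {V : Type*} [AddCommMonoid V] [Finite A] (hST : ∀ s ∈ S, ∀ t ∈ T, s < t)
    (F : cell A (S ∪ T) → V) :
    ∑ M : cell A T, ∑ N : cell A S, F (cellMulEquiv A hST (N, M)).1 =
      (Nat.card A ^ (S.card * T.card)) • ∑ K, F K := by
  rw [Finset.sum_comm, ← Fintype.sum_prod_type' (f := fun N M => F (cellMulEquiv A hST (N, M)).1),
    Equiv.sum_comp (cellMulEquiv A hST) fun y => F y.1, Fintype.sum_prod_type]
  simp only [Finset.sum_const, Finset.card_univ]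
  rw [← Finset.smul_sum, ← Nat.card_eq_fintype_card, natCard_rect]

end Shear

end Matrix

/-! ### The representatives D_S(1+N) and their uniqueness -/

namespace PadicGL

open Matrix

section Unipotent

variable {n : ℕ} {A : Type*} [CommRing A]

/-- The invertible matrix `1 + N`, for `N` of square zero. -/
def unip (N : Matrix (Fin n) (Fin n) A) (h : N * N = 0) : GL (Fin n) A where
  val := 1 + N
  inv := 1 - N
  val_inv := by rw [add_mul, one_mul, mul_sub, mul_one, h]; abel
  inv_val := by rw [sub_mul, one_mul, mul_add, mul_one, h]; abel

theorem coe_unip (N : Matrix (Fin n) (Fin n) A) (h : N * N = 0) :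
    (unip N h : Matrix (Fin n) (Fin n) A) = 1 + N := rfl

theorem coe_unip_inv (N : Matrix (Fin n) (Fin n) A) (h : N * N = 0) :
    ((unip N h)⁻¹ : GL (Fin n) A).val = 1 - N := rfl

end Unipotent

variable (p : ℕ) [Fact p.Prime] {n : ℕ}

/-- The inclusion `GL_n(ℤ_p) → GL_n(ℚ_p)`. -/
noncomputable abbrev incl (n : ℕ) : GL (Fin n) ℤ_[p] →* GL (Fin n) ℚ_[p] :=
  GeneralLinearGroup.map (n := Fin n) (PadicInt.Coe.ringHom (p := p))

variable {p}

theorem incl_mem (g : GL (Fin n) ℤ_[p]) : incl p n g ∈ integral p n := ⟨g, rfl⟩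

theorem incl_apply (g : GL (Fin n) ℤ_[p]) (i j : Fin n) :
    incl p n g i j = ((g i j : ℤ_[p]) : ℚ_[p]) := rfl

theorem norm_apply_le_one {g : GL (Fin n) ℚ_[p]} (hg : g ∈ integral p n) (i j : Fin n) :
    ‖g i j‖ ≤ 1 := by
  obtain ⟨h, rfl⟩ := hg
  exact (h i j).2

theorem mem_integral_of_coe_eq_map {g : GL (Fin n) ℚ_[p]} {M : Matrix (Fin n) (Fin n) ℤ_[p]}
    (h : (g : Matrix (Fin n) (Fin n) ℚ_[p]) = M.map (PadicInt.Coe.ringHom (p := p)))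
    (hM : IsUnit M.det) : g ∈ integral p n :=
  ⟨GeneralLinearGroup.mk'' M hM, Units.ext h.symm⟩

theorem norm_det_eq_one {g : GL (Fin n) ℚ_[p]} (hg : g ∈ integral p n) :
    ‖(g : Matrix (Fin n) (Fin n) ℚ_[p]).det‖ = 1 := by
  obtain ⟨h, rfl⟩ := hg
  have h1 : (incl p n h : Matrix (Fin n) (Fin n) ℚ_[p]).det =
      PadicInt.Coe.ringHom (p := p) (h : Matrix (Fin n) (Fin n) ℤ_[p]).det :=
    ((PadicInt.Coe.ringHom (p := p)).map_det _).symm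
  rw [h1]
  exact PadicInt.isUnit_iff.1 ((Matrix.isUnit_iff_isUnit_det _).1 h.isUnit)

section Parabolic

variable {k : ℕ} {b : Fin n → Fin k}

/-- The diagonal entry at a block of size one is a character of the parabolic subgroup. For b = id
this covers every diagonal entry of the Borel subgroup. -/
theorem mul_apply_of_isolated {g h : GL (Fin n) ℚ_[p]} (hg : g ∈ parabolic p b)
    (hh : h ∈ parabolic p b) {i : Fin n} (hi : ∀ j, b j = b i → j = i) :
    (g * h) i i = g i i * h i i := by
  rw [GeneralLinearGroup.coe_mul, mul_apply]
  refine Finset.sum_eq_single i (fun j _ hj => ?_) (by simp)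
  rcases lt_trichotomy (b j) (b i) with h1 | h1 | h1
  · rw [hg h1, zero_mul]
  · exact absurd (hi j h1) hj
  · rw [hh h1, mul_zero]

theorem norm_apply_eq_one_of_isolated {g : GL (Fin n) ℚ_[p]} (hg : g ∈ integral p n)
    (hb : g ∈ parabolic p b) {i : Fin n} (hi : ∀ j, b j = b i → j = i) : ‖g i i‖ = 1 := by
  have h := mul_apply_of_isolated hb ((parabolic p b).inv_mem hb) hi
  rw [mul_inv_cancel, GeneralLinearGroup.coe_one, one_apply_eq] at h
  have h1 := norm_apply_le_one hg i i
  have h2 := norm_apply_le_one ((integral p n).inv_mem hg) i i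
  have h3 : 1 = ‖g i i‖ * ‖(g⁻¹ : GL (Fin n) ℚ_[p]) i i‖ := by
    rw [← norm_mul, ← h, norm_one]
  refine le_antisymm h1 ?_
  calc (1 : ℝ) = ‖g i i‖ * ‖(g⁻¹ : GL (Fin n) ℚ_[p]) i i‖ := h3
    _ ≤ ‖g i i‖ * 1 := mul_le_mul_of_nonneg_left h2 (norm_nonneg _)
    _ = ‖g i i‖ := mul_one _

theorem borel_le_parabolic (hb : Monotone b) :
    parabolic p (id : Fin n → Fin n) ≤ parabolic p b :=
  fun _ hg _ _ hij => hg (hb.reflect_lt hij)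

end Parabolic

variable (p) in
/-- The diagonal entries of `D_S`: `p` in the positions in `S` and `1` elsewhere. -/
noncomputable def delta (S : Finset (Fin n)) (i : Fin n) : ℚ_[p]ˣ :=
  if i ∈ S then GL4Hecke.pU p else 1

theorem coe_delta_of_mem {S : Finset (Fin n)} {i : Fin n} (h : i ∈ S) :
    (delta p S i : ℚ_[p]) = p := by simp [delta, h, GL4Hecke.pU]

theorem coe_delta_of_notMem {S : Finset (Fin n)} {i : Fin n} (h : i ∉ S) :
    (delta p S i : ℚ_[p]) = 1 := by simp [delta, h]

theorem norm_delta_eq_iff {S T : Finset (Fin n)} {i : Fin n} :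
    ‖(delta p S i : ℚ_[p])‖ = ‖(delta p T i : ℚ_[p])‖ ↔ (i ∈ S ↔ i ∈ T) := by
  by_cases hS : i ∈ S <;> by_cases hT : i ∈ T <;>
    simp [coe_delta_of_mem, coe_delta_of_notMem, hS, hT, (Fact.out : p.Prime).ne_one]

theorem coe_diag (d : Fin n → ℚ_[p]ˣ) :
    (diag p d : Matrix (Fin n) (Fin n) ℚ_[p]) = diagonal fun i => (d i : ℚ_[p]) := rfl

theorem diag_mul_eq_mul_diag {d e : Fin n → ℚ_[p]ˣ} {g h : GL (Fin n) ℚ_[p]}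
    (H : ∀ i j, (d i : ℚ_[p]) * g i j = h i j * e j) : diag p d * g = h * diag p e := by
  refine GeneralLinearGroup.ext fun i j => ?_
  rw [GeneralLinearGroup.coe_mul, GeneralLinearGroup.coe_mul, coe_diag, coe_diag, diagonal_mul,
    mul_diagonal, H]

theorem det_diag_delta (S : Finset (Fin n)) :
    (diag p (delta p S) : Matrix (Fin n) (Fin n) ℚ_[p]).det = (p : ℚ_[p]) ^ S.card := by
  rw [coe_diag, det_diagonal, ← Finset.prod_const, ← Finset.prod_filter_mul_prod_filter_not
    Finset.univ (· ∈ S)]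
  rw [Finset.prod_congr rfl fun i hi => coe_delta_of_mem (Finset.mem_filter.1 hi).2,
    Finset.prod_congr rfl (fun i hi => coe_delta_of_notMem (Finset.mem_filter.1 hi).2)]
  simp

/-- The representative `D_S (1 + N)`. -/
noncomputable def rep (S : Finset (Fin n)) (N : cell ℤ_[p] S) : GL (Fin n) ℚ_[p] :=
  diag p (delta p S) * incl p n (unip N.1 (cell_mul_cell N.2 N.2))

theorem incl_unip_mem_borel {S : Finset (Fin n)} (N : cell ℤ_[p] S) :
    incl p n (unip N.1 (cell_mul_cell N.2 N.2)) ∈ parabolic p (id : Fin n → Fin n) := by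
  intro i j hij
  change j < i at hij
  change (((1 + N.1 : Matrix (Fin n) (Fin n) ℤ_[p]) i j : ℤ_[p]) : ℚ_[p]) = 0
  rw [Matrix.add_apply, one_apply_ne hij.ne', N.2 i j fun h => absurd h.2.2 (not_lt.2 hij.le)]
  simp

theorem rep_mem_borel (S : Finset (Fin n)) (N : cell ℤ_[p] S) :
    rep S N ∈ parabolic p (id : Fin n → Fin n) :=
  mul_mem (diag_mem_parabolic p _ _) (incl_unip_mem_borel N)

theorem rep_apply (S : Finset (Fin n)) (N : cell ℤ_[p] S) (i j : Fin n) :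
    rep S N i j = (delta p S i : ℚ_[p]) * (((1 + N.1 : Matrix (Fin n) (Fin n) ℤ_[p]) i j : ℤ_[p]) : ℚ_[p]) := by
  rw [rep, GeneralLinearGroup.coe_mul, coe_diag, diagonal_mul]
  rfl

theorem rep_apply_self (S : Finset (Fin n)) (N : cell ℤ_[p] S) (i : Fin n) :
    rep S N i i = (delta p S i : ℚ_[p]) := by
  rw [rep_apply, Matrix.add_apply, one_apply_eq, N.2 i i fun h => absurd h.2.2 (lt_irrefl i)]
  simp

theorem det_rep (S : Finset (Fin n)) (N : cell ℤ_[p] S) :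
    ‖(rep S N : Matrix (Fin n) (Fin n) ℚ_[p]).det‖ = ‖(p : ℚ_[p])‖ ^ S.card := by
  rw [rep, GeneralLinearGroup.coe_mul, det_mul, norm_mul, norm_det_eq_one (incl_mem _), mul_one,
    det_diag_delta, norm_pow]

/-- If M = N + pK, then 1 + M = (1 + pK)(1 + N), since K N = 0. Moreover D_S(1 + pK) = (1 + K)D_S,
since D_S is 1 on the rows of K and p on its columns. So only N mod p matters for the coset. -/
theorem exists_mul_rep_eq {S : Finset (Fin n)} {N M : cell ℤ_[p] S}
    (h : N.1.map PadicInt.toZMod = M.1.map PadicInt.toZMod) :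
    ∃ γ ∈ integral p n, rep S M = γ * rep S N := by
  have hdvd : ∀ i j, (p : ℤ_[p]) ∣ M.1 i j - N.1 i j := by
    intro i j
    rw [← Ideal.mem_span_singleton, ← PadicInt.maximalIdeal_eq_span_p, ← PadicInt.ker_toZMod,
      RingHom.mem_ker, map_sub, sub_eq_zero]
    exact (congrFun (congrFun h i) j).symm
  choose K hK using hdvd
  have hKS : (of K) ∈ cell ℤ_[p] S := by
    intro i j hij
    have := hK i j
    rw [M.2 i j hij, N.2 i j hij, sub_zero, eq_comm, mul_eq_zero] at this
    exact this.resolve_left (Nat.cast_ne_zero.2 (Fact.out : p.Prime).ne_zero)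
  have hM : M.1 = (p : ℤ_[p]) • of K + N.1 := by
    ext i j
    rw [Matrix.add_apply, Matrix.smul_apply, of_apply, smul_eq_mul, ← hK, sub_add_cancel]
  have hpK : (p : ℤ_[p]) • of K ∈ cell ℤ_[p] S := fun i j hij => by
    rw [Matrix.smul_apply, hKS i j hij, smul_zero]
  refine ⟨incl p n (unip (of K) (cell_mul_cell hKS hKS)), incl_mem _, ?_⟩
  have h1 : unip M.1 (cell_mul_cell M.2 M.2) =
      unip _ (cell_mul_cell hpK hpK) * unip N.1 (cell_mul_cell N.2 N.2) := by
    refine Units.ext ?_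
    rw [Units.val_mul, coe_unip, coe_unip, coe_unip, add_mul, one_mul, mul_add, mul_one,
      cell_mul_cell hpK N.2, hM]
    abel
  rw [rep, h1, map_mul, ← mul_assoc, rep, ← mul_assoc]
  congr 1
  refine diag_mul_eq_mul_diag fun i j => ?_
  simp only [incl_apply, coe_unip, Matrix.add_apply, Matrix.smul_apply, of_apply, smul_eq_mul]
  by_cases hij : cellRel S i j
  · rw [coe_delta_of_notMem hij.1, coe_delta_of_mem hij.2.1, one_apply_ne hij.2.2.ne]
    push_cast
    ring
  · have h0 : K i j = 0 := hKS i j hij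
    rw [h0]
    by_cases hij : i = j
    · subst hij
      simp
    · simp [one_apply_ne hij]

/-- As a quotient of upper triangular matrices, γ is upper triangular. Being integral with integral
inverse, it has units on the diagonal, so the diagonals of D_S and D_T have equal norms. -/
theorem eq_of_mul_rep_eq {S T : Finset (Fin n)} {N : cell ℤ_[p] S} {M : cell ℤ_[p] T}
    {γ : GL (Fin n) ℚ_[p]} (hγ : γ ∈ integral p n) (h : γ * rep S N = rep T M) : S = T := by
  have hb : γ ∈ parabolic p (id : Fin n → Fin n) := by
    rw [eq_mul_inv_of_mul_eq h]
    exact mul_mem (rep_mem_borel T M) (inv_mem (rep_mem_borel S N))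
  ext i
  have hi : ∀ j : Fin n, id j = id i → j = i := fun j hj => hj
  rw [← norm_delta_eq_iff (p := p), ← rep_apply_self T M, ← h,
    mul_apply_of_isolated hb (rep_mem_borel S N) hi, norm_mul,
    norm_apply_eq_one_of_isolated hγ hb hi, one_mul, rep_apply_self]

/-- The hypothesis gives γ D_S = D_S(1 + (M - N)). At a position with i ∉ S, j ∈ S this reads γ_ij p
= M_ij - N_ij, with γ_ij integral. -/
theorem map_toZMod_eq_of_mul_rep_eq {S : Finset (Fin n)} {N M : cell ℤ_[p] S}
    {γ : GL (Fin n) ℚ_[p]} (hγ : γ ∈ integral p n) (h : γ * rep S N = rep S M) :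
    N.1.map PadicInt.toZMod = M.1.map PadicInt.toZMod := by
  obtain ⟨g, rfl⟩ := hγ
  have h1 : incl p n g * diag p (delta p S) = diag p (delta p S) *
      incl p n (unip M.1 (cell_mul_cell M.2 M.2) * (unip N.1 (cell_mul_cell N.2 N.2))⁻¹) := by
    rw [map_mul, map_inv, ← mul_assoc, eq_mul_inv_iff_mul_eq, mul_assoc]
    exact h
  have h2 : (unip M.1 (cell_mul_cell M.2 M.2) * (unip N.1 (cell_mul_cell N.2 N.2))⁻¹ :
      GL (Fin n) ℤ_[p]).val = 1 + (M.1 - N.1) := by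
    rw [Units.val_mul, coe_unip, coe_unip_inv, add_mul, one_mul, mul_sub, mul_one,
      cell_mul_cell M.2 N.2]
    abel
  ext i j
  rw [map_apply, map_apply, eq_comm, ← sub_eq_zero, ← map_sub, ← RingHom.mem_ker,
    PadicInt.ker_toZMod, PadicInt.maximalIdeal_eq_span_p, Ideal.mem_span_singleton]
  by_cases hij : cellRel S i j
  · have h3 := congrArg (fun z : GL (Fin n) ℚ_[p] => z i j) h1
    simp only [GeneralLinearGroup.coe_mul, coe_diag, diagonal_mul, mul_diagonal] at h3
    rw [coe_delta_of_notMem hij.1, coe_delta_of_mem hij.2.1, incl_apply, one_mul] at h3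
    refine ⟨g i j, ?_⟩
    have h4 : incl p n (unip M.1 (cell_mul_cell M.2 M.2) *
        (unip N.1 (cell_mul_cell N.2 N.2))⁻¹) i j = ((M.1 i j - N.1 i j : ℤ_[p]) : ℚ_[p]) := by
      rw [incl_apply, h2, Matrix.add_apply, one_apply_ne hij.2.2.ne, zero_add, Matrix.sub_apply]
    have h5 := h3.trans h4
    apply Subtype.val_injective
    rw [← h5]
    push_cast
    ring
  · rw [M.2 i j hij, N.2 i j hij, sub_zero]
    exact dvd_zero _

end PadicGL

/-! ### Echelon reduction over a commutative ring -/

namespace Matrix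

variable {n : ℕ} {A : Type*} [CommRing A]

/-- Gauss elimination: the row space of an upper triangular matrix contains reduced vectors with
leading entries in all columns where the diagonal entry is a unit. -/
theorem exists_reduced_row {M : Matrix (Fin n) (Fin n) A} (hM : ∀ i j, j < i → M i j = 0)
    {S : Finset (Fin n)} (hS : ∀ i ∉ S, IsUnit (M i i)) (i : Fin n) (hi : i ∉ S) :
    ∃ v ∈ Submodule.span A (Set.range M.row),
      v i = 1 ∧ ∀ j, j < i ∨ (j ∉ S ∧ j ≠ i) → v j = 0 := by
  induction i using WellFoundedGT.induction with
  | ind i ih =>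
  have ih' : ∀ j, ∃ v ∈ Submodule.span A (Set.range M.row), i < j → j ∉ S →
      v j = 1 ∧ ∀ k, k < j ∨ (k ∉ S ∧ k ≠ j) → v k = 0 := by
    intro j
    by_cases h : i < j ∧ j ∉ S
    · obtain ⟨v, hv, hv'⟩ := ih j h.1 h.2
      exact ⟨v, hv, fun _ _ => hv'⟩
    · exact ⟨0, zero_mem _, fun h1 h2 => absurd ⟨h1, h2⟩ h⟩
  choose v hvL hv using ih'
  obtain ⟨c, hc⟩ := (hS i hi).exists_left_inv
  classical
  let F : Finset (Fin n) := Finset.univ.filter fun j => i < j ∧ j ∉ S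
  have hF : ∀ {j}, j ∈ F → i < j ∧ j ∉ S := fun h => (Finset.mem_filter.1 h).2
  -- Scale row i to have leading entry 1, then clear the later pivot columns. The vectors v j vanish
  -- in each other's pivot columns, so clearing one leaves the others unchanged.
  refine ⟨c • M.row i - ∑ j ∈ F, (c * M i j) • v j, ?_, ?_, ?_⟩
  · refine sub_mem (Submodule.smul_mem _ _ (Submodule.subset_span ⟨i, rfl⟩))
      (Submodule.sum_mem _ fun j _ => Submodule.smul_mem _ _ (hvL j))
  · have h0 : ∑ j ∈ F, (c * M i j) * v j i = 0 := Finset.sum_eq_zero fun j hj => by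
      rw [(hv j (hF hj).1 (hF hj).2).2 i (Or.inl (hF hj).1), mul_zero]
    simp [Matrix.row, Finset.sum_apply, h0, hc]
  · intro k hk
    have h0 : ∀ j ∈ F, j ≠ k → (c * M i j) * v j k = 0 := by
      intro j hj hjk
      rw [(hv j (hF hj).1 (hF hj).2).2 k, mul_zero]
      rcases hk with hk | hk
      · exact Or.inl (hk.trans (hF hj).1)
      · exact Or.inr ⟨hk.1, hjk.symm⟩
    simp only [Pi.sub_apply, Pi.smul_apply, Finset.sum_apply, smul_eq_mul, Matrix.row]
    by_cases hkF : k ∈ F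
    · rw [Finset.sum_eq_single_of_mem k hkF h0, (hv k (hF hkF).1 (hF hkF).2).1, mul_one, sub_self]
    · rw [Finset.sum_eq_zero fun j hj => h0 j hj fun h => hkF (h ▸ hj), sub_zero, hM i k, mul_zero]
      rcases hk with hk | hk
      · exact hk
      · refine lt_of_le_of_ne (not_lt.1 fun h => hkF ?_) hk.2
        exact Finset.mem_filter.2 ⟨Finset.mem_univ _, h, hk.1⟩

open Classical in
/-- If `p` annihilates the cokernel of an upper triangular matrix `M`, then its row space contains
the rows of an echelon matrix. -/
theorem exists_mul_eq_echelon {M W : Matrix (Fin n) (Fin n) A} (hM : ∀ i j, j < i → M i j = 0)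
    {q : A} (hW : W * M = q • 1) {S : Finset (Fin n)} (hS : ∀ i ∉ S, IsUnit (M i i)) :
    ∃ (U : Matrix (Fin n) (Fin n) A) (N : cell A S),
      U * M = diagonal (fun i => if i ∈ S then q else 1) * (1 + N.1) := by
  have hspan : ∀ v ∈ Submodule.span A (Set.range M.row), ∃ u : Fin n → A, u ᵥ* M = v := by
    intro v hv
    obtain ⟨u, hu⟩ := (Submodule.mem_span_range_iff_exists_fun A).1 hv
    refine ⟨u, ?_⟩
    rw [← hu]
    ext j
    simp [vecMul, dotProduct, Finset.sum_apply, Matrix.row]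
  have h1 : ∀ i, ∃ v : Fin n → A, (∃ u : Fin n → A, u ᵥ* M = v) ∧ (i ∉ S → v i = 1 ∧
      ∀ j, j < i ∨ (j ∉ S ∧ j ≠ i) → v j = 0) := by
    intro i
    by_cases hi : i ∈ S
    · exact ⟨0, ⟨0, zero_vecMul M⟩, fun h => absurd hi h⟩
    · obtain ⟨v, hv, hv'⟩ := exists_reduced_row hM hS i hi
      exact ⟨v, hspan v hv, fun _ => hv'⟩
  choose v hu hv using h1
  choose u hu using hu
  -- The rows in S are to be q times unit vectors, which W provides; the others are the reduced
  -- vectors.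
  refine ⟨of fun i => if i ∈ S then W i else u i,
    ⟨restrict (cellRel S) (of v), restrict_mem _ _⟩, ?_⟩
  ext i j
  rw [diagonal_mul, Matrix.add_apply]
  change _ = _ * ((1 : Matrix (Fin n) (Fin n) A) i j + restrict (cellRel S) (of v) i j)
  by_cases hi : i ∈ S
  · have h2 := congrFun (congrFun hW i) j
    rw [restrict_apply_of_neg (r := cellRel S) _ fun h => h.1 hi, add_zero]
    simpa [mul_apply, hi] using h2
  · have h2 : ((of fun i => if i ∈ S then W i else u i) * M) i j = v i j := by
      rw [← hu i]
      simp [mul_apply, hi, vecMul, dotProduct]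
    rw [h2, if_neg hi, one_mul]
    by_cases hc : cellRel S i j
    · rw [restrict_apply_of_pos (r := cellRel S) _ hc, one_apply_ne hc.2.2.ne, zero_add, of_apply]
    · rw [restrict_apply_of_neg (r := cellRel S) _ hc, add_zero]
      by_cases hij : i = j
      · subst hij
        rw [(hv i hi).1, one_apply_eq]
      · rw [one_apply_ne hij, (hv i hi).2 j]
        by_cases hj : j < i
        · exact Or.inl hj
        · exact Or.inr ⟨fun h => hc ⟨hi, h, lt_of_le_of_ne (not_lt.1 hj) hij⟩, fun h => hij h.symm⟩

end Matrix

/-! ### Existence of the representatives -/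

namespace PadicGL

open Matrix

variable {p : ℕ} [Fact p.Prime] {n : ℕ}

/-- A non-unit is divisible by p; as it also divides p, it is associated to p. -/
theorem norm_eq_of_not_isUnit {x w : ℤ_[p]} (hx : ¬ IsUnit x) (h : w * x = p) :
    ‖x‖ = ‖(p : ℤ_[p])‖ := by
  have h1 : (p : ℤ_[p]) ∣ x := by
    rw [← PadicInt.norm_lt_one_iff_dvd]
    exact lt_of_le_of_ne (PadicInt.norm_le_one x) fun h => hx (PadicInt.isUnit_iff.2 h)
  obtain ⟨u, hu⟩ := associated_of_dvd_dvd h1 ⟨w, by rw [← h, mul_comm]⟩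
  rw [← hu, norm_mul, PadicInt.isUnit_iff.1 u.isUnit, mul_one]

theorem map_diagonal_delta (S : Finset (Fin n)) [DecidablePred (· ∈ S)] :
    (diagonal fun i => if i ∈ S then (p : ℤ_[p]) else 1).map (PadicInt.Coe.ringHom (p := p)) =
      (diag p (delta p S) : Matrix (Fin n) (Fin n) ℚ_[p]) := by
  rw [coe_diag, diagonal_map (map_zero _)]
  congr 1
  ext i
  by_cases hi : i ∈ S
  · simp [coe_delta_of_mem hi, hi]
  · simp [coe_delta_of_notMem hi, hi]

/-- Every right coset in the double coset of `D_S` is represented by some `D_T (1 + N)`. -/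
theorem exists_rep_eq (S : Finset (Fin n)) {γ : GL (Fin n) ℚ_[p]} (hγ : γ ∈ integral p n) :
    ∃ (T : Finset (Fin n)) (N : cell ℤ_[p] T), ∃ γ' ∈ integral p n,
      rep T N = γ' * (diag p (delta p S) * γ) := by
  classical
  obtain ⟨γ', hγ', s, hs, h⟩ := iwasawa (p := p) (b := (id : Fin n → Fin n)) monotone_id
    (diag p (delta p S) * γ)
  obtain ⟨g, rfl⟩ := hγ
  obtain ⟨g', rfl⟩ := hγ'
  let D : Matrix (Fin n) (Fin n) ℤ_[p] := diagonal fun i => if i ∈ S then (p : ℤ_[p]) else 1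
  -- This is p D_S⁻¹. It makes W = p s⁻¹ integral, so that p annihilates the cokernel of the
  -- integral triangular matrix M = s.
  let D' : Matrix (Fin n) (Fin n) ℤ_[p] := diagonal fun i => if i ∈ S then 1 else (p : ℤ_[p])
  have hD : D' * D = (p : ℤ_[p]) • 1 := by
    rw [diagonal_mul_diagonal, smul_one_eq_diagonal]
    congr 1
    ext i
    by_cases hi : i ∈ S <;> simp [hi]
  let M : Matrix (Fin n) (Fin n) ℤ_[p] := (g'⁻¹ : GL (Fin n) ℤ_[p]).val * (D * g.val)
  let W : Matrix (Fin n) (Fin n) ℤ_[p] := (g⁻¹ : GL (Fin n) ℤ_[p]).val * D' * g'.val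
  have hWM : W * M = (p : ℤ_[p]) • 1 := by
    calc W * M = (g⁻¹ : GL (Fin n) ℤ_[p]).val * (D' * ((g'.val * (g'⁻¹ : GL (Fin n) ℤ_[p]).val) *
          D)) * g.val := by simp only [W, M, Matrix.mul_assoc]
      _ = (p : ℤ_[p]) • 1 := by
        rw [Units.mul_inv, Matrix.one_mul, hD, Matrix.mul_smul, Matrix.mul_one, Matrix.smul_mul,
          Units.inv_mul]
  have hMs : M.map (PadicInt.Coe.ringHom (p := p)) = (s : Matrix (Fin n) (Fin n) ℚ_[p]) := by
    have h1 : s = incl p n g'⁻¹ * (diag p (delta p S) * incl p n g) := by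
      rw [map_inv, eq_inv_mul_iff_mul_eq]
      exact h.symm
    rw [h1, GeneralLinearGroup.coe_mul, GeneralLinearGroup.coe_mul, ← map_diagonal_delta,
      Matrix.map_mul, Matrix.map_mul]
    rfl
  have hcoe : ∀ i j, ((M i j : ℤ_[p]) : ℚ_[p]) = s i j := fun i j => congrFun (congrFun hMs i) j
  have hMt : ∀ i j, j < i → M i j = 0 := fun i j hij => by
    apply Subtype.val_injective
    rw [hcoe i j]
    exact hs hij
  let T : Finset (Fin n) := Finset.univ.filter fun i => ¬ IsUnit (M i i)
  have hT : ∀ {i}, i ∈ T ↔ ¬ IsUnit (M i i) := fun {i} => by simp [T]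
  obtain ⟨U, N, hU⟩ := exists_mul_eq_echelon (S := T) hMt hWM fun i hi =>
    not_not.1 fun h => hi (hT.2 h)
  have hUr : U.map (PadicInt.Coe.ringHom (p := p)) * (s : Matrix (Fin n) (Fin n) ℚ_[p]) =
      (rep T N : Matrix (Fin n) (Fin n) ℚ_[p]) := by
    rw [← hMs, ← Matrix.map_mul]
    have h2 := congrArg (fun Z => Z.map (PadicInt.Coe.ringHom (p := p))) hU
    simp only [Matrix.map_mul] at h2
    rw [Matrix.map_mul, h2]
    rw [rep, GeneralLinearGroup.coe_mul, ← map_diagonal_delta]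
    congr 2
  have hγU : ((rep T N * s⁻¹ : GL (Fin n) ℚ_[p]) : Matrix (Fin n) (Fin n) ℚ_[p]) =
      U.map (PadicInt.Coe.ringHom (p := p)) := by
    rw [GeneralLinearGroup.coe_mul, ← hUr, Matrix.mul_assoc, ← GeneralLinearGroup.coe_mul,
      mul_inv_cancel, GeneralLinearGroup.coe_one, Matrix.mul_one]
  -- Over ℚ_p, U is rep T N · s⁻¹, hence triangular. It remains to see that rep T N and s have
  -- diagonal entries of equal norm: 1 outside T, and the norm of p on T.
  have hdet : IsUnit U.det := by
    have hmem : rep T N * s⁻¹ ∈ parabolic p (id : Fin n → Fin n) :=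
      mul_mem (rep_mem_borel T N) (inv_mem hs)
    have h3 : PadicInt.Coe.ringHom (p := p) U.det =
        ∏ i, (rep T N * s⁻¹ : GL (Fin n) ℚ_[p]) i i := by
      rw [RingHom.map_det, RingHom.mapMatrix_apply, ← hγU]
      exact det_of_isUpperTriangular hmem
    rw [PadicInt.isUnit_iff]
    change ‖PadicInt.Coe.ringHom (p := p) U.det‖ = 1
    rw [h3, norm_prod]
    refine Finset.prod_eq_one fun i _ => ?_
    have hi : ∀ j : Fin n, id j = id i → j = i := fun j hj => hj
    have hsi := mul_apply_of_isolated hs (inv_mem hs) hi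
    rw [mul_inv_cancel, GeneralLinearGroup.coe_one, one_apply_eq] at hsi
    rw [mul_apply_of_isolated (rep_mem_borel T N) (inv_mem hs) hi, rep_apply_self]
    have hn : ‖(delta p T i : ℚ_[p])‖ = ‖s i i‖ := by
      rw [← hcoe i i]
      by_cases hiT : i ∈ T
      -- Take w = p (s⁻¹)_ii, a diagonal entry of the integral matrix W. Since s is triangular,
      -- (s⁻¹)_ii is the inverse of s_ii.
      · have hw : ∃ w : ℤ_[p], w * M i i = p := by
          have hpp : ‖(p : ℚ_[p]) * (s⁻¹ : GL (Fin n) ℚ_[p]) i i‖ ≤ 1 := by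
            have hWs : W.map (PadicInt.Coe.ringHom (p := p)) =
                (p : ℚ_[p]) • (s⁻¹ : GL (Fin n) ℚ_[p]).val := by
              have h4 := congrArg (fun Z => Z.map (PadicInt.Coe.ringHom (p := p))) hWM
              simp only [Matrix.map_mul, hMs] at h4
              have h5 : (((p : ℤ_[p]) • (1 : Matrix (Fin n) (Fin n) ℤ_[p])).map
                  (PadicInt.Coe.ringHom (p := p))) = (p : ℚ_[p]) • 1 := by
                ext a b
                by_cases hab : a = b <;> simp [hab, one_apply]
              rw [h5] at h4
              have h6 := congrArg (· * (s⁻¹ : GL (Fin n) ℚ_[p]).val) h4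
              simpa only [Matrix.mul_assoc, Units.mul_inv, Matrix.mul_one, Matrix.smul_mul,
                Matrix.one_mul] using h6
            have h7 := congrFun (congrFun hWs i) i
            rw [Matrix.smul_apply, smul_eq_mul] at h7
            rw [← h7]
            exact (W i i).2
          refine ⟨⟨_, hpp⟩, Subtype.val_injective ?_⟩
          change (p : ℚ_[p]) * (s⁻¹ : GL (Fin n) ℚ_[p]) i i * ((M i i : ℤ_[p]) : ℚ_[p]) =
            ((p : ℤ_[p]) : ℚ_[p])
          rw [hcoe, mul_assoc, mul_comm _ (s i i), ← hsi, mul_one, PadicInt.coe_natCast]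
        obtain ⟨w, hw⟩ := hw
        rw [coe_delta_of_mem hiT, ← PadicInt.norm_def, norm_eq_of_not_isUnit (hT.1 hiT) hw,
          PadicInt.norm_def, PadicInt.coe_natCast]
      · rw [coe_delta_of_notMem hiT, ← PadicInt.norm_def, norm_one, eq_comm,
          ← PadicInt.isUnit_iff]
        exact not_not.1 fun h => hiT (hT.2 h)
    rw [norm_mul, hn, ← norm_mul, ← hsi, norm_one]
  refine ⟨T, N, rep T N * s⁻¹ * (incl p n g')⁻¹,
    mul_mem (mem_integral_of_coe_eq_map hγU hdet) (inv_mem (incl_mem g')), ?_⟩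
  rw [h]
  group

/-- The permutation matrices. -/
noncomputable def permGL (σ : Equiv.Perm (Fin n)) : GL (Fin n) ℤ_[p] :=
  GeneralLinearGroup.mk'' (σ.permMatrix ℤ_[p]) (by
    rw [det_permutation]
    exact (Units.isUnit (Equiv.Perm.sign σ)).map (Int.castRingHom ℤ_[p]))

theorem incl_permGL_apply (σ : Equiv.Perm (Fin n)) (i j : Fin n) :
    incl p n (permGL σ) i j = if σ i = j then 1 else 0 := by
  rw [incl_apply]
  change ((σ.permMatrix ℤ_[p] i j : ℤ_[p]) : ℚ_[p]) = _
  rw [Equiv.Perm.permMatrix, PEquiv.toMatrix_apply]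
  by_cases h : σ i = j <;> simp [h]

theorem incl_permGL_mem_parabolic {k : ℕ} {b : Fin n → Fin k} {σ : Equiv.Perm (Fin n)}
    (hσ : ∀ i, b (σ i) = b i) : incl p n (permGL σ) ∈ parabolic p b := by
  intro i j hij
  rw [incl_permGL_apply, if_neg]
  rintro rfl
  rw [hσ] at hij
  exact lt_irrefl _ hij

theorem diag_mul_permGL {S T : Finset (Fin n)} {σ : Equiv.Perm (Fin n)}
    (h : ∀ i, σ i ∈ S ↔ i ∈ T) : diag p (delta p T) * incl p n (permGL σ) =
      incl p n (permGL σ) * diag p (delta p S) := by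
  refine diag_mul_eq_mul_diag fun i j => ?_
  rw [incl_permGL_apply]
  by_cases hij : σ i = j
  · subst hij
    by_cases hi : i ∈ T
    · simp [coe_delta_of_mem hi, coe_delta_of_mem ((h i).2 hi)]
    · simp [coe_delta_of_notMem hi, coe_delta_of_notMem (fun h' => hi ((h i).1 h'))]
  · simp [hij]

end PadicGL

/-! ### Formal sums of cosets -/

namespace HeckeAlg

variable {G : Type*} [Group G] {R : Type*} [CommRing R] {Γ : Subgroup G}

theorem doubleCoset_toFinsupp [IsHeckeTriple (⊤ : Submonoid G) Γ Γ] {g : G} {ι : Type*}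
    (F : Finset ι) (f : ι → RightCoset Γ) (hf : Set.InjOn f F)
    (h : ∀ c, c ∈ cosetsIn Γ g ↔ ∃ i ∈ F, f i = c) :
    (doubleCoset R Γ g).toFinsupp = ∑ i ∈ F, Finsupp.single (f i) 1 := by
  classical
  have h1 : (cosetsIn_finite Γ g).toFinset = F.image f := by
    ext c
    rw [Set.Finite.mem_toFinset, h, Finset.mem_image]
  change ∑ c ∈ (cosetsIn_finite Γ g).toFinset, Finsupp.single c 1 = _
  rw [h1, Finset.sum_image hf]

theorem convolve_sum {ι : Type*} (f : RightCoset Γ →₀ R) (s : Finset ι)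
    (h : ι → RightCoset Γ →₀ R) : convolve f (∑ i ∈ s, h i) = ∑ i ∈ s, convolve f (h i) :=
  map_sum (AddMonoidHom.mk' (convolve f) (convolve_add f)) h s

theorem toFinsupp_nsmul (k : ℕ) (X : HeckeAlg R Γ) : (k • X).toFinsupp = k • X.toFinsupp :=
  map_nsmul (AddMonoidHom.mk' (toFinsupp : HeckeAlg R Γ → _) toFinsupp_add) k X

end HeckeAlg

/-! ### Double cosets as sums of echelon cosets -/

namespace PadicGL

open Matrix

variable {p : ℕ} [Fact p.Prime] {n k : ℕ} {b : Fin n → Fin k}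

/-- The lift of the entries to `{0, …, p - 1}`. -/
noncomputable def cellLift {S : Finset (Fin n)} (N : cell (ZMod p) S) : cell ℤ_[p] S :=
  ⟨N.1.map fun x => ((x.val : ℕ) : ℤ_[p]), map_mem_supported N.2 (by simp)⟩

theorem map_cellLift {S : Finset (Fin n)} (N : cell (ZMod p) S) :
    (cellLift N).1.map PadicInt.toZMod = N.1 := by
  ext i j
  simp [cellLift]

theorem exists_eq_mul_rep_cellLift {S : Finset (Fin n)} (N : cell ℤ_[p] S) :
    ∃ N' : cell (ZMod p) S, ∃ γ ∈ integral p n, rep S (cellLift N') = γ * rep S N :=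
  ⟨⟨N.1.map PadicInt.toZMod, map_mem_supported N.2 (map_zero _)⟩,
    exists_mul_rep_eq (by rw [map_cellLift])⟩

theorem rep_cellLift_injective {S T : Finset (Fin n)} {N : cell (ZMod p) S} {M : cell (ZMod p) T}
    {γ : GL (Fin n) ℚ_[p]} (hγ : γ ∈ integral p n)
    (h : γ * rep S (cellLift N) = rep T (cellLift M)) :
    (⟨S, N⟩ : Σ S : Finset (Fin n), cell (ZMod p) S) = ⟨T, M⟩ := by
  obtain rfl := eq_of_mul_rep_eq hγ h
  have := map_toZMod_eq_of_mul_rep_eq hγ h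
  rw [map_cellLift, map_cellLift] at this
  rw [Subtype.ext this]

/-- D_T commutes with 1 + N, because N has neither rows nor columns in T. The product is therefore
D_{S∪T}(1+N)(1+M) = D_{S∪T}(1+F)(1+K), where F is the S × T block of M. D_{S∪T} is the scalar p on
the rows and columns of F, so 1 + F moves to the left and is absorbed into the coset. -/
theorem rep_mul_rep {S T : Finset (Fin n)} (hST : ∀ s ∈ S, ∀ t ∈ T, s < t)
    (N : cell (ZMod p) S) (M : cell (ZMod p) T) : ∃ γ ∈ integral p n,
      rep (S ∪ T) (cellLift (cellMulEquiv (ZMod p) hST (N, M)).1) =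
        γ * (rep S (cellLift N) * rep T (cellLift M)) := by
  set N' := cellLift N with hN'
  set M' := cellLift M with hM'
  have hK := cellMul_mem hST N'.2 M'.2
  -- Lifting to {0, …, p-1} does not respect sums or products, so K formed over ℤ_p agrees with the
  -- lift of K formed over F_p only modulo p. This suffices for equality of cosets.
  obtain ⟨γ, hγ, h⟩ := exists_mul_rep_eq (N := ⟨_, hK⟩)
    (M := cellLift (cellMulEquiv (ZMod p) hST (N, M)).1) (by
      rw [map_cellLift, cellMulEquiv_fst, cellMul_map, hN', hM', map_cellLift, map_cellLift])
  have hF2 : restrict (rectRel S T) M'.1 * restrict (rectRel S T) M'.1 = 0 :=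
    mul_eq_zero_of_supported (restrict_mem _ _) (restrict_mem _ _) fun i j l h h' =>
      lt_irrefl j (hST j h'.1 j h.2)
  have hu : unip N'.1 (cell_mul_cell N'.2 N'.2) * unip M'.1 (cell_mul_cell M'.2 M'.2) =
      unip _ hF2 * unip _ (cell_mul_cell hK hK) :=
    Units.ext (one_add_mul_one_add hST N'.2 M'.2)
  have hD : diag p (delta p S) * diag p (delta p T) = diag p (delta p (S ∪ T)) := by
    refine Units.ext ?_
    rw [Units.val_mul, coe_diag, coe_diag, coe_diag, diagonal_mul_diagonal]
    congr 1
    ext i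
    by_cases hS : i ∈ S
    · rw [coe_delta_of_mem hS, coe_delta_of_notMem fun hT => lt_irrefl i (hST i hS i hT),
        coe_delta_of_mem (Finset.mem_union_left _ hS), mul_one]
    · rw [coe_delta_of_notMem hS, one_mul]
      by_cases hT : i ∈ T
      · rw [coe_delta_of_mem hT, coe_delta_of_mem (Finset.mem_union_right _ hT)]
      · rw [coe_delta_of_notMem hT, coe_delta_of_notMem (by simp [hS, hT])]
  have hc1 : diag p (delta p T) * incl p n (unip N'.1 (cell_mul_cell N'.2 N'.2)) =
      incl p n (unip N'.1 (cell_mul_cell N'.2 N'.2)) * diag p (delta p T) := by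
    refine diag_mul_eq_mul_diag fun i j => ?_
    rw [incl_apply, coe_unip, Matrix.add_apply]
    by_cases hij : cellRel S i j
    · rw [coe_delta_of_notMem fun hT => lt_irrefl i (hij.2.2.trans (hST j hij.2.1 i hT)),
        coe_delta_of_notMem fun hT => lt_irrefl j (hST j hij.2.1 j hT), one_mul, mul_one]
    · rw [N'.2 i j hij, add_zero]
      by_cases h : i = j
      · subst h
        rw [mul_comm]
      · simp [one_apply_ne h]
  have hc2 : diag p (delta p (S ∪ T)) * incl p n (unip _ hF2) =
      incl p n (unip _ hF2) * diag p (delta p (S ∪ T)) := by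
    refine diag_mul_eq_mul_diag fun i j => ?_
    rw [incl_apply, coe_unip, Matrix.add_apply]
    by_cases hij : rectRel S T i j
    · rw [coe_delta_of_mem (Finset.mem_union_left _ hij.1),
        coe_delta_of_mem (Finset.mem_union_right _ hij.2), mul_comm]
    · rw [restrict_apply_of_neg _ hij, add_zero]
      by_cases h : i = j
      · subst h
        rw [mul_comm]
      · simp [one_apply_ne h]
  have hmul : rep S N' * rep T M' = incl p n (unip _ hF2) * rep (S ∪ T) ⟨_, hK⟩ := by
    calc rep S N' * rep T M' = diag p (delta p S) *
          (incl p n (unip N'.1 (cell_mul_cell N'.2 N'.2)) * diag p (delta p T)) *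
          incl p n (unip M'.1 (cell_mul_cell M'.2 M'.2)) := by simp only [rep, mul_assoc]
      _ = (diag p (delta p S) * diag p (delta p T)) *
          incl p n (unip N'.1 (cell_mul_cell N'.2 N'.2) *
            unip M'.1 (cell_mul_cell M'.2 M'.2)) := by
        rw [← hc1, map_mul]
        simp only [mul_assoc]
      _ = incl p n (unip _ hF2) * rep (S ∪ T) ⟨_, hK⟩ := by
        rw [hD, hu, map_mul, ← mul_assoc, hc2, mul_assoc, rep]
  refine ⟨γ * (incl p n (unip _ hF2))⁻¹, mul_mem hγ (inv_mem (incl_mem _)), ?_⟩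
  rw [hmul, h]
  group

/-- The norm of the determinant is constant on a double coset and determines the number of entries
p. -/
theorem card_eq_of_rep_eq {S T : Finset (Fin n)} {N : cell ℤ_[p] T} {γ' γ : GL (Fin n) ℚ_[p]}
    (hγ' : γ' ∈ integral p n) (hγ : γ ∈ integral p n)
    (h : rep T N = γ' * (diag p (delta p S) * γ)) : T.card = S.card := by
  have h1 := congrArg (fun g : GL (Fin n) ℚ_[p] => ‖(g : Matrix (Fin n) (Fin n) ℚ_[p]).det‖) h
  simp only [GeneralLinearGroup.coe_mul, det_mul, norm_mul, det_rep, norm_det_eq_one hγ',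
    norm_det_eq_one hγ, det_diag_delta, norm_pow, one_mul, mul_one] at h1
  refine (pow_right_strictAnti₀ ?_ Padic.norm_p_lt_one).injective h1
  exact norm_pos_iff.2 (Nat.cast_ne_zero.2 (Fact.out : p.Prime).ne_zero)

/-- The diagonal entry at a block of size one is multiplicative on P and a unit on the integral
points of P, so its norm is an invariant of the double coset. -/
theorem mem_iff_of_rep_eq {S T : Finset (Fin n)} {N : cell ℤ_[p] T} {γ' γ : GL (Fin n) ℚ_[p]}
    (hb : Monotone b) (hγ' : γ' ∈ integral p n) (hγ : γ ∈ integral p n)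
    (hγb : γ ∈ parabolic p b) (h : rep T N = γ' * (diag p (delta p S) * γ)) {i : Fin n}
    (hi : ∀ j, b j = b i → j = i) : i ∈ T ↔ i ∈ S := by
  have hN := borel_le_parabolic hb (rep_mem_borel T N)
  have hD := diag_mem_parabolic p b (delta p S)
  have hγ'b : γ' ∈ parabolic p b := by
    rw [← mul_inv_eq_iff_eq_mul.2 h]
    exact mul_mem hN (inv_mem (mul_mem hD hγb))
  rw [← norm_delta_eq_iff (p := p), ← rep_apply_self T N, h,
    mul_apply_of_isolated hγ'b (mul_mem hD hγb) hi, mul_apply_of_isolated hD hγb hi, norm_mul,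
    norm_mul, norm_apply_eq_one_of_isolated hγ' hγ'b hi, norm_apply_eq_one_of_isolated hγ hγb hi,
    coe_diag, diagonal_apply_eq, one_mul, mul_one]

/-- With w the permutation matrix of σ, D_T(1+N) = w · D_S · w⁻¹(1+N). Both outer factors lie in P
because σ preserves the blocks. -/
theorem exists_rep_eq_mul_diag_mul {S T : Finset (Fin n)} (N : cell ℤ_[p] T) (hb : Monotone b)
    {σ : Equiv.Perm (Fin n)} (hσ : ∀ i, b (σ i) = b i) (h : ∀ i, σ i ∈ S ↔ i ∈ T) :
    ∃ γ' ∈ integral p n, ∃ γ ∈ integral p n, γ' ∈ parabolic p b ∧ γ ∈ parabolic p b ∧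
      rep T N = γ' * (diag p (delta p S) * γ) := by
  have hw := incl_permGL_mem_parabolic (p := p) hσ
  refine ⟨incl p n (permGL σ), incl_mem _, (incl p n (permGL σ))⁻¹ * incl p n (unip N.1 _),
    mul_mem (inv_mem (incl_mem _)) (incl_mem _), hw,
    mul_mem (inv_mem hw) (borel_le_parabolic hb (incl_unip_mem_borel N)), ?_⟩
  rw [← mul_assoc, ← diag_mul_permGL h, rep]
  group

/-- The family `𝒮` consists of the position sets that occur in the double coset of `D_S`. -/
structure IsOrbit (b : Fin n → Fin k) (S : Finset (Fin n)) (𝒮 : Finset (Finset (Fin n))) :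
    Prop where
  mem : ∀ T : Finset (Fin n), T.card = S.card →
    (∀ i, (∀ j, b j = b i → j = i) → (i ∈ T ↔ i ∈ S)) → T ∈ 𝒮
  exists_perm : ∀ T ∈ 𝒮, ∃ σ : Equiv.Perm (Fin n), (∀ i, b (σ i) = b i) ∧ ∀ i, σ i ∈ S ↔ i ∈ T

variable (R : Type*) [CommRing R]

/-- The representative `D_S (1 + N)` as an element of a parabolic subgroup. -/
noncomputable def parabolicRep (hb : Monotone b) (S : Finset (Fin n)) (N : cell (ZMod p) S) :
    parabolic p b :=
  ⟨rep S (cellLift N), borel_le_parabolic hb (rep_mem_borel S _)⟩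

/-- The sum of all right cosets of matrices `D_S (1 + N)`. -/
noncomputable def echelonSum (p : ℕ) [Fact p.Prime] (hb : Monotone b) (S : Finset (Fin n)) :
    RightCoset (parabolicIntegral p b) →₀ R :=
  ∑ N : cell (ZMod p) S, Finsupp.single (RightCoset.mk _ (parabolicRep hb S N)) 1

theorem doubleCoset_integral_toFinsupp {S : Finset (Fin n)} {𝒮 : Finset (Finset (Fin n))}
    (h𝒮 : IsOrbit (fun _ : Fin n => (0 : Fin 1)) S 𝒮) :
    (HeckeAlg.doubleCoset R (integral p n) (diag p (delta p S))).toFinsupp =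
      ∑ T ∈ 𝒮, ∑ N : cell (ZMod p) T,
        Finsupp.single (RightCoset.mk _ (rep T (cellLift N))) 1 := by
  have hb : Monotone (fun _ : Fin n => (0 : Fin 1)) := monotone_const
  -- With a single block the parabolic subgroup is all of GL_n, so the lemmas on parabolic subgroups
  -- apply.
  have htop : ∀ g : GL (Fin n) ℚ_[p], g ∈ parabolic p (fun _ : Fin n => (0 : Fin 1)) :=
    fun g i j h => absurd h (lt_irrefl _)
  rw [Finset.sum_sigma' 𝒮 (fun T => (Finset.univ : Finset (cell (ZMod p) T)))
    fun T N => Finsupp.single (RightCoset.mk _ (rep T (cellLift N))) 1]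
  refine HeckeAlg.doubleCoset_toFinsupp _ (fun x : Σ T : Finset (Fin n), cell (ZMod p) T =>
    RightCoset.mk (integral p n) (rep x.1 (cellLift x.2))) ?_ ?_
  · rintro ⟨T, N⟩ - ⟨T', N'⟩ - h
    exact rep_cellLift_injective (RightCoset.mk_eq_mk.1 h) (by group)
  · intro c
    constructor
    · rintro ⟨γ, hγ, rfl⟩
      obtain ⟨T, N, γ', hγ', h⟩ := exists_rep_eq S hγ
      obtain ⟨N', γ₁, hγ₁, h₁⟩ := exists_eq_mul_rep_cellLift N
      refine ⟨⟨T, N'⟩, Finset.mem_sigma.2 ⟨h𝒮.mem T (card_eq_of_rep_eq hγ' hγ h) fun i hi =>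
        mem_iff_of_rep_eq hb hγ' hγ (htop _) h hi, Finset.mem_univ _⟩, ?_⟩
      rw [RightCoset.mk_eq_mk, h₁, h, ← inv_mem_iff]
      convert mul_mem hγ₁ hγ' using 1
      group
    · rintro ⟨⟨T, N⟩, hT, rfl⟩
      obtain ⟨σ, hσ, hσ'⟩ := h𝒮.exists_perm T (Finset.mem_sigma.1 hT).1
      obtain ⟨γ', hγ', γ, hγ, -, -, h⟩ := exists_rep_eq_mul_diag_mul (cellLift N) hb hσ hσ'
      refine ⟨γ, hγ, ?_⟩
      rw [RightCoset.mk_eq_mk, h, ← inv_mem_iff]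
      convert hγ' using 1
      group

theorem doubleCoset_parabolic_toFinsupp (hb : Monotone b) {S : Finset (Fin n)}
    {𝒮 : Finset (Finset (Fin n))} (h𝒮 : IsOrbit b S 𝒮) :
    (HeckeAlg.doubleCoset R (parabolicIntegral p b)
      ⟨diag p (delta p S), diag_mem_parabolic p b _⟩).toFinsupp =
      ∑ T ∈ 𝒮, echelonSum R p hb T := by
  simp only [echelonSum]
  rw [Finset.sum_sigma' 𝒮 (fun T => (Finset.univ : Finset (cell (ZMod p) T)))
    fun T N => Finsupp.single (RightCoset.mk _ (parabolicRep hb T N)) 1]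
  refine HeckeAlg.doubleCoset_toFinsupp _ (fun x : Σ T : Finset (Fin n), cell (ZMod p) T =>
    RightCoset.mk (parabolicIntegral p b) (parabolicRep hb x.1 x.2)) ?_ ?_
  · rintro ⟨T, N⟩ - ⟨T', N'⟩ - h
    exact rep_cellLift_injective (Subgroup.mem_subgroupOf.1 (RightCoset.mk_eq_mk.1 h))
      (inv_mul_cancel_right (rep T' (cellLift N')) (rep T (cellLift N)))
  · intro c
    constructor
    · rintro ⟨⟨γ, hγb⟩, hγ, rfl⟩
      rw [Subgroup.mem_subgroupOf] at hγ
      obtain ⟨T, N, γ', hγ', h⟩ := exists_rep_eq S hγ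
      obtain ⟨N', γ₁, hγ₁, h₁⟩ := exists_eq_mul_rep_cellLift N
      refine ⟨⟨T, N'⟩, Finset.mem_sigma.2 ⟨h𝒮.mem T (card_eq_of_rep_eq hγ' hγ h) fun i hi =>
        mem_iff_of_rep_eq hb hγ' hγ hγb h hi, Finset.mem_univ _⟩, ?_⟩
      rw [RightCoset.mk_eq_mk, Subgroup.mem_subgroupOf]
      change diag p (delta p S) * γ * (rep T (cellLift _))⁻¹ ∈ _
      rw [h₁, h, ← inv_mem_iff]
      convert mul_mem hγ₁ hγ' using 1
      group
    · rintro ⟨⟨T, N⟩, hT, rfl⟩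
      obtain ⟨σ, hσ, hσ'⟩ := h𝒮.exists_perm T (Finset.mem_sigma.1 hT).1
      obtain ⟨γ', hγ', γ, hγ, -, hγb, h⟩ := exists_rep_eq_mul_diag_mul (cellLift N) hb hσ hσ'
      refine ⟨⟨γ, hγb⟩, hγ, ?_⟩
      rw [RightCoset.mk_eq_mk, Subgroup.mem_subgroupOf]
      change diag p (delta p S) * γ * (rep T (cellLift N))⁻¹ ∈ _
      rw [h, ← inv_mem_iff]
      convert hγ' using 1
      group

/-- The representatives are upper triangular, hence already in P, and ε keeps them as they are. -/
theorem embedding_doubleCoset_toFinsupp (hb : Monotone b) {S : Finset (Fin n)}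
    {𝒮 : Finset (Finset (Fin n))} (h𝒮 : IsOrbit (fun _ : Fin n => (0 : Fin 1)) S 𝒮) :
    (HeckeAlg.embedding R (iwasawa (p := p) hb)
      (HeckeAlg.doubleCoset R (integral p n) (diag p (delta p S)))).toFinsupp =
      ∑ T ∈ 𝒮, echelonSum R p hb T := by
  change HeckeAlg.restrictCosets R (iwasawa hb) (HeckeAlg.toFinsupp _) = _
  rw [doubleCoset_integral_toFinsupp R h𝒮, map_sum]
  refine Finset.sum_congr rfl fun T _ => ?_
  rw [map_sum]
  exact Finset.sum_congr rfl fun N _ =>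
    HeckeAlg.restrictCosets_single (iwasawa hb) (parabolicRep hb T N) 1

/-! ### The multiplication rule -/

/-- Right multiplication by `echelonSum R p hb T` on invariant sums of cosets. -/
noncomputable def mulEchelonSum (p : ℕ) [Fact p.Prime] (hb : Monotone b) (T : Finset (Fin n)) :
    (RightCoset (parabolicIntegral p b) →₀ R) →ₗ[R] (RightCoset (parabolicIntegral p b) →₀ R) :=
  ∑ M : cell (ZMod p) T, HeckeAlg.translate R _ (parabolicRep hb T M)

variable {R} in
-- Invariance of f allows the arbitrary representatives in `convolve` to be replaced by D_T(1+M).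
-- The resulting operator is linear on all formal sums, so it can be evaluated on the non-invariant
-- summands of f.
theorem convolve_echelonSum (hb : Monotone b) (T : Finset (Fin n))
    {f : RightCoset (parabolicIntegral p b) →₀ R} (hf : f ∈ HeckeAlg.invariants R _) :
    HeckeAlg.convolve f (echelonSum R p hb T) = mulEchelonSum R p hb T f := by
  rw [echelonSum, HeckeAlg.convolve_sum, mulEchelonSum, LinearMap.sum_apply]
  refine Finset.sum_congr rfl fun M _ => ?_
  rw [HeckeAlg.convolve_single hf, one_smul]

/-- By `rep_mul_rep` each product of representatives lies in the coset attached to K, and by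
`sum_cellMul` each K occurs p^(|S||T|) times. -/
theorem mulEchelonSum_echelonSum (hb : Monotone b) {S T : Finset (Fin n)}
    (hST : ∀ s ∈ S, ∀ t ∈ T, s < t) : mulEchelonSum R p hb T (echelonSum R p hb S) =
      (p ^ (S.card * T.card)) • echelonSum R p hb (S ∪ T) := by
  have h := sum_cellMul (A := ZMod p) hST fun K =>
    Finsupp.single (RightCoset.mk (parabolicIntegral p b) (parabolicRep hb (S ∪ T) K)) (1 : R)
  rw [Nat.card_zmod] at h
  rw [echelonSum, echelonSum, ← h, mulEchelonSum, LinearMap.sum_apply]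
  refine Finset.sum_congr rfl fun M _ => ?_
  rw [map_sum]
  refine Finset.sum_congr rfl fun N _ => ?_
  rw [HeckeAlg.translate_single]
  congr 1
  rw [RightCoset.mk_eq_mk, Subgroup.mem_subgroupOf]
  obtain ⟨γ, hγ, h'⟩ := rep_mul_rep hST N M
  change rep (S ∪ T) (cellLift _) * (rep S (cellLift N) * rep T (cellLift M))⁻¹ ∈ _
  rwa [h', mul_inv_cancel_right]

end PadicGL

/-! ### Expansion of the factorisation -/

section Polynomial

open Polynomial

/-- Only X is central here; the coefficients need not commute, so every product keeps the order of
the factors. -/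
theorem Polynomial.linear_mul_quadratic_mul_linear {A : Type*} [Ring A] (a b c d : A) :
    (1 - C a * X) * (1 - C b * X + C c * X ^ 2) * (1 - C d * X) =
      1 - C (a + b + d) * X + C (c + a * b + a * d + b * d) * X ^ 2
        - C (a * c + a * b * d + c * d) * X ^ 3 + C (a * c * d) * X ^ 4 := by
  have h (u v : A) (i j : ℕ) : C u * X ^ i * (C v * X ^ j) = C (u * v) * X ^ (i + j) := by
    rw [C_mul, pow_add, mul_assoc, ← mul_assoc (X ^ i), X_pow_mul, mul_assoc, mul_assoc]
  have h1 (u : A) : C u * X = C u * X ^ 1 := by rw [pow_one]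
  simp only [h1, mul_add, add_mul, mul_sub, sub_mul, one_mul, mul_one, h, C_add]
  abel

end Polynomial

/-! ### The case of GL_4 and blocks 1, 2, 1 -/

namespace GL4Hecke

open PadicGL HeckeAlg

variable (p : ℕ) [Fact p.Prime] (R : Type*) [CommRing R]

/-- The symmetric group on four letters is transitive on subsets of given size; this is checked by
enumeration. -/
theorem isOrbit_const {S : Finset (Fin 4)} :
    IsOrbit (fun _ : Fin 4 => (0 : Fin 1)) S (Finset.univ.filter fun T => T.card = S.card) where
  mem T hT _ := Finset.mem_filter.2 ⟨Finset.mem_univ _, hT⟩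
  exists_perm := by
    revert S
    decide +kernel

/-- Size and membership of 0 and 3 fix the size of T ∩ {1, 2}, and the only nontrivial
block-preserving permutation swaps 1 and 2. -/
theorem isOrbit_blocks {S : Finset (Fin 4)} :
    IsOrbit blocks S (Finset.univ.filter fun T =>
      T.card = S.card ∧ (0 ∈ T ↔ 0 ∈ S) ∧ (3 ∈ T ↔ 3 ∈ S)) where
  mem T hT h := Finset.mem_filter.2
    ⟨Finset.mem_univ _, hT, h 0 (by decide), h 3 (by decide)⟩
  exists_perm := by
    revert S
    decide +kernel

/-- The sum of all right cosets of echelon matrices with `p` at the positions in `S`. -/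
noncomputable abbrev E (S : Finset (Fin 4)) :
    RightCoset (parabolicIntegral p blocks) →₀ R := echelonSum R p blocks_monotone S

theorem ε_T_toFinsupp {a b c d : ℚ_[p]ˣ} {S : Finset (Fin 4)} (h : ![a, b, c, d] = delta p S) :
    (ε p R (T p R a b c d)).toFinsupp =
      ∑ T ∈ Finset.univ.filter (fun T => T.card = S.card), E p R T := by
  rw [T, h]
  exact embedding_doubleCoset_toFinsupp R blocks_monotone isOrbit_const

theorem T₀_toFinsupp {a b c d : ℚ_[p]ˣ} {S : Finset (Fin 4)} (h : ![a, b, c, d] = delta p S) :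
    (T₀ p R a b c d).toFinsupp =
      ∑ T ∈ Finset.univ.filter (fun T => T.card = S.card ∧ (0 ∈ T ↔ 0 ∈ S) ∧ (3 ∈ T ↔ 3 ∈ S)),
        E p R T := by
  rw [← doubleCoset_parabolic_toFinsupp R blocks_monotone isOrbit_blocks, T₀]
  simp only [h]

theorem LambdaMinus13_toFinsupp : (LambdaMinus13 p R).toFinsupp = E p R {0} := by
  rw [LambdaMinus13, T₀_toFinsupp p R (S := {0}) (by ext i; fin_cases i <;> simp [delta])]
  rw [show (Finset.univ.filter fun T : Finset (Fin 4) => T.card = ({0} : Finset (Fin 4)).card ∧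
    (0 ∈ T ↔ 0 ∈ ({0} : Finset (Fin 4))) ∧ (3 ∈ T ↔ 3 ∈ ({0} : Finset (Fin 4)))) = {{0}} by
    decide +kernel, Finset.sum_singleton]

theorem LambdaPlus31_toFinsupp : (LambdaPlus31 p R).toFinsupp = E p R {3} := by
  rw [LambdaPlus31, T₀_toFinsupp p R (S := {3}) (by ext i; fin_cases i <;> simp [delta])]
  rw [show (Finset.univ.filter fun T : Finset (Fin 4) => T.card = ({3} : Finset (Fin 4)).card ∧
    (0 ∈ T ↔ 0 ∈ ({3} : Finset (Fin 4))) ∧ (3 ∈ T ↔ 3 ∈ ({3} : Finset (Fin 4)))) = {{3}} by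
    decide +kernel, Finset.sum_singleton]

theorem X₁_toFinsupp : (X₁ p R).toFinsupp = E p R {1} + E p R {2} := by
  rw [X₁, T₀_toFinsupp p R (S := {2}) (by ext i; fin_cases i <;> simp [delta])]
  rw [show (Finset.univ.filter fun T : Finset (Fin 4) => T.card = ({2} : Finset (Fin 4)).card ∧
    (0 ∈ T ↔ 0 ∈ ({2} : Finset (Fin 4))) ∧ (3 ∈ T ↔ 3 ∈ ({2} : Finset (Fin 4)))) = {{1}, {2}} by
    decide +kernel, Finset.sum_pair (by decide)]

theorem X₂_toFinsupp : (X₂ p R).toFinsupp = E p R {1, 2} := by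
  rw [X₂, T₀_toFinsupp p R (S := {1, 2}) (by ext i; fin_cases i <;> simp [delta])]
  rw [show (Finset.univ.filter fun T : Finset (Fin 4) => T.card = ({1, 2} : Finset (Fin 4)).card ∧
    (0 ∈ T ↔ 0 ∈ ({1, 2} : Finset (Fin 4))) ∧ (3 ∈ T ↔ 3 ∈ ({1, 2} : Finset (Fin 4)))) =
      {{1, 2}} by decide +kernel, Finset.sum_singleton]

theorem ε_T₁_toFinsupp : (ε p R (T p R 1 1 1 (pU p))).toFinsupp =
    E p R {0} + E p R {1} + E p R {2} + E p R {3} := by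
  rw [ε_T_toFinsupp p R (S := {3}) (by ext i; fin_cases i <;> simp [delta]),
    show (Finset.univ.filter fun T : Finset (Fin 4) => T.card = ({3} : Finset (Fin 4)).card) =
      {{0}, {1}, {2}, {3}} by decide +kernel]
  simp [Finset.sum_insert, add_assoc]

theorem ε_T₂_toFinsupp : (ε p R (T p R 1 1 (pU p) (pU p))).toFinsupp =
    E p R {0, 1} + E p R {0, 2} + E p R {0, 3} + E p R {1, 2} + E p R {1, 3} + E p R {2, 3} := by
  rw [ε_T_toFinsupp p R (S := {2, 3}) (by ext i; fin_cases i <;> simp [delta]),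
    show (Finset.univ.filter fun T : Finset (Fin 4) => T.card = ({2, 3} : Finset (Fin 4)).card) =
      {{0, 1}, {0, 2}, {0, 3}, {1, 2}, {1, 3}, {2, 3}} by decide +kernel]
  repeat rw [Finset.sum_insert (by decide)]
  rw [Finset.sum_singleton]
  abel

theorem ε_T₃_toFinsupp : (ε p R (T p R 1 (pU p) (pU p) (pU p))).toFinsupp =
    E p R {0, 1, 2} + E p R {0, 1, 3} + E p R {0, 2, 3} + E p R {1, 2, 3} := by
  rw [ε_T_toFinsupp p R (S := {1, 2, 3}) (by ext i; fin_cases i <;> simp [delta]),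
    show (Finset.univ.filter fun T : Finset (Fin 4) =>
      T.card = ({1, 2, 3} : Finset (Fin 4)).card) =
      {{0, 1, 2}, {0, 1, 3}, {0, 2, 3}, {1, 2, 3}} by decide +kernel]
  repeat rw [Finset.sum_insert (by decide)]
  rw [Finset.sum_singleton]
  abel

theorem ε_Δ_toFinsupp : (ε p R (T p R (pU p) (pU p) (pU p) (pU p))).toFinsupp =
    E p R {0, 1, 2, 3} := by
  rw [ε_T_toFinsupp p R (S := {0, 1, 2, 3}) (by ext i; fin_cases i <;> simp [delta]),
    show (Finset.univ.filter fun T : Finset (Fin 4) =>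
      T.card = ({0, 1, 2, 3} : Finset (Fin 4)).card) = {{0, 1, 2, 3}} by decide +kernel,
    Finset.sum_singleton]

variable {p R}

theorem mul_toFinsupp {X Y : H121 p R} {T : Finset (Fin 4)} (hY : Y.toFinsupp = E p R T) :
    (X * Y).toFinsupp = mulEchelonSum R p blocks_monotone T X.toFinsupp := by
  rw [toFinsupp_mul, hY, convolve_echelonSum _ _ X.toFinsupp_mem]

theorem mulEchelonSum_E {S T U : Finset (Fin 4)} {m : ℕ} (hST : ∀ s ∈ S, ∀ t ∈ T, s < t)
    (hU : S ∪ T = U) (hm : S.card * T.card = m) :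
    mulEchelonSum R p blocks_monotone T (E p R S) = p ^ m • E p R U := by
  rw [← hU, ← hm]
  exact mulEchelonSum_echelonSum R blocks_monotone hST

variable (p R)

theorem LambdaMinus13_mul_X₁_toFinsupp : (LambdaMinus13 p R * X₁ p R).toFinsupp =
    p • (E p R {0, 1} + E p R {0, 2}) := by
  rw [toFinsupp_mul, X₁_toFinsupp, convolve_add, convolve_echelonSum _ _ (toFinsupp_mem _),
    convolve_echelonSum _ _ (toFinsupp_mem _), LambdaMinus13_toFinsupp,
    mulEchelonSum_E (U := {0, 1}) (m := 1) (by decide) (by decide) (by decide),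
    mulEchelonSum_E (U := {0, 2}) (m := 1) (by decide) (by decide) (by decide), pow_one, smul_add]

theorem LambdaMinus13_mul_X₂_toFinsupp : (LambdaMinus13 p R * X₂ p R).toFinsupp =
    p ^ 2 • E p R {0, 1, 2} := by
  rw [mul_toFinsupp (X₂_toFinsupp p R), LambdaMinus13_toFinsupp,
    mulEchelonSum_E (U := {0, 1, 2}) (m := 2) (by decide) (by decide) (by decide)]

theorem ε_T₁ : ε p R (T p R 1 1 1 (pU p)) = LambdaMinus13 p R + X₁ p R + LambdaPlus31 p R := by
  apply toFinsupp_injective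
  rw [ε_T₁_toFinsupp, toFinsupp_add, toFinsupp_add, LambdaMinus13_toFinsupp, X₁_toFinsupp,
    LambdaPlus31_toFinsupp]
  abel

theorem ε_T₂ : (p : H121 p R) * ε p R (T p R 1 1 (pU p) (pU p)) =
    (p : H121 p R) * X₂ p R + LambdaMinus13 p R * X₁ p R + LambdaMinus13 p R * LambdaPlus31 p R +
      X₁ p R * LambdaPlus31 p R := by
  apply toFinsupp_injective
  -- Here `map_add` splits X₁ into E({1}) and E({2}), which is legitimate only for the linear
  -- operator, not for the Hecke product.
  simp only [← nsmul_eq_mul, toFinsupp_add, toFinsupp_nsmul, ε_T₂_toFinsupp, X₂_toFinsupp,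
    LambdaMinus13_mul_X₁_toFinsupp, mul_toFinsupp (LambdaPlus31_toFinsupp p R),
    LambdaMinus13_toFinsupp, X₁_toFinsupp, map_add]
  rw [mulEchelonSum_E (S := {0}) (U := {0, 3}) (m := 1) (by decide) (by decide) (by decide),
    mulEchelonSum_E (S := {1}) (U := {1, 3}) (m := 1) (by decide) (by decide) (by decide),
    mulEchelonSum_E (S := {2}) (U := {2, 3}) (m := 1) (by decide) (by decide) (by decide)]
  simp only [pow_one, smul_add]
  abel

theorem ε_T₃ : (p : H121 p R) ^ 3 * ε p R (T p R 1 (pU p) (pU p) (pU p)) =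
    LambdaMinus13 p R * ((p : H121 p R) * X₂ p R) +
      LambdaMinus13 p R * X₁ p R * LambdaPlus31 p R +
      (p : H121 p R) * X₂ p R * LambdaPlus31 p R := by
  apply toFinsupp_injective
  simp only [← Nat.cast_pow, ← nsmul_eq_mul, mul_smul_comm, toFinsupp_add, toFinsupp_nsmul,
    ε_T₃_toFinsupp, LambdaMinus13_mul_X₂_toFinsupp, mul_toFinsupp (LambdaPlus31_toFinsupp p R),
    LambdaMinus13_mul_X₁_toFinsupp, X₂_toFinsupp, map_add, map_nsmul]
  rw [mulEchelonSum_E (S := {0, 1}) (U := {0, 1, 3}) (m := 2) (by decide) (by decide) (by decide),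
    mulEchelonSum_E (S := {0, 2}) (U := {0, 2, 3}) (m := 2) (by decide) (by decide) (by decide),
    mulEchelonSum_E (S := {1, 2}) (U := {1, 2, 3}) (m := 2) (by decide) (by decide) (by decide)]
  -- Each term carries p · p²: one factor p from the coefficient of X₂ or from Λ₋X₁, and p² from a
  -- product of a singleton with a pair.
  simp only [smul_add, smul_smul, ← pow_succ']
  abel

theorem ε_Δ : (p : H121 p R) ^ 6 * ε p R (T p R (pU p) (pU p) (pU p) (pU p)) =
    LambdaMinus13 p R * ((p : H121 p R) * X₂ p R) * LambdaPlus31 p R := by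
  apply toFinsupp_injective
  simp only [← Nat.cast_pow, ← nsmul_eq_mul, mul_smul_comm, toFinsupp_nsmul, ε_Δ_toFinsupp,
    mul_toFinsupp (LambdaPlus31_toFinsupp p R), LambdaMinus13_mul_X₂_toFinsupp, map_nsmul]
  -- The exponent is 6 = 1 + 2 + 3: from the coefficient p of X₂, from Λ₋X₂, and from multiplication
  -- by Λ₊.
  rw [mulEchelonSum_E (S := {0, 1, 2}) (U := {0, 1, 2, 3}) (m := 3) (by decide) (by decide)
    (by decide), smul_smul, smul_smul, ← pow_succ', ← pow_add]

end GL4Hecke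

theorem mainTheorem5 (p : ℕ) [Fact p.Prime] (R : Type*) [CommRing R] :
    (GL4Hecke.Q4 p R).map (GL4Hecke.ε p R) =
      (1 - Polynomial.C (GL4Hecke.LambdaMinus13 p R) * Polynomial.X) *
      (1 - Polynomial.C (GL4Hecke.X₁ p R) * Polynomial.X
        + Polynomial.C ((p : GL4Hecke.H121 p R) * GL4Hecke.X₂ p R) * Polynomial.X ^ 2) *
      (1 - Polynomial.C (GL4Hecke.LambdaPlus31 p R) * Polynomial.X) := by
  rw [Polynomial.linear_mul_quadratic_mul_linear, ← GL4Hecke.ε_T₁, ← GL4Hecke.ε_T₂,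
    ← GL4Hecke.ε_T₃, ← GL4Hecke.ε_Δ]
  simp [GL4Hecke.Q4]
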